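/- Let $E$ be a real $d\times d$ matrix all of whose complex eigenvalues have positive real part, let $q=\operatorname{trace}(E)$, and for $c>0$ let $c^E=\exp(E\log c)$. Let $\|x\|_0=\int_0^1\|t^Ex\|\,\frac{dt}{t}$, a norm on $\mathbb R^d$, and for $x\neq0$ let $\tau(x)$ be the unique $r>0$ with $\|r^{-E}x\|_0=1$; put $\tau(0)=0$. Let $\beta>0$ and let $\varphi:\mathbb R^d\to[0,\infty)$ be a continuous function with $\varphi(x)>0$ for $x\ne0$ such that - ($E$-homogeneity) $\varphi(c^Ex)=c\,\varphi(x)$ for all $c>0$ and $x\neq0$; - ($(\beta,E)$-admissibility) for all $0<A<B$ there is a constant $C>0$ such that $|\varphi(x+y)-\varphi(y)|\le C\,\tau(x)^\beta$ whenever $A\le\|y\|\le B$ and $\tau(x)\le1$. Let $0<\alpha\le2$ and $0<H<\beta$, and let $Z_\alpha$ be an independently scattered symmetric $\alpha$-stable random measure on $\mathbb R^d$ with Lebesgue control measure $\lambda$ (that is, for Borel sets of finite Lebesgue measure, $\mathbb E\,e^{itZ_\alpha(A)}=e^{-\lambda(A)|t|^\alpha}$, the values of $Z_\alpha$ on disjoint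 sets are independent, and $Z_\alpha(\bigcup_jA_j)=\sum_jZ_\alpha(A_j)$ almost surely for disjoint $A_1,A_2,\dots$ whose union has finite Lebesgue measure). Then the random field $$X_\varphi(x)=\int_{\mathbb R^d}\Bigl(\varphi(x-y)^{H-q/\alpha}-\varphi(-y)^{H-q/\alpha}\Bigr)\,Z_\alpha(dy),\qquad x\in\mathbb R^d,$$ (the integral being the limit in probability of the integrals of simple functions that converge to the integrand in $L^\alpha(\mathbb R^d)$) exists and has the following properties: (a) it is operator scaling: for every $c>0$, the fields $\{X_\varphi(c^Ex)\}_{x\in\mathbb R^d}$ and $\{c^HX_\varphi(x)\}_{x\in\mathbb R^d}$ have the same finite-dimensional distributions; (b) it has stationary increments: for every $h\in\mathbb R^d$, the fields $\{X_\varphi(x+h)-X_\varphi(h)\}_{x\in\mathbb R^d}$ and $\{X_\varphi(x)\}_{x\in\mathbb R^d}$ have the same finite-dimensional distributions. -/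

import Mathlib

open MeasureTheory ProbabilityTheory Filter Topology

noncomputable section

namespace OperatorScaling

/-- `ℝ^d` with its Euclidean norm and Lebesgue measure. -/
abbrev Space (d : ℕ) : Type := EuclideanSpace ℝ (Fin d)

/-- Every (complex) eigenvalue of the real matrix `E` has positive real part. -/
def HasPositiveSpectrum {d : ℕ} (E : Matrix (Fin d) (Fin d) ℝ) : Prop :=
  ∀ z ∈ spectrum ℂ (E.map Complex.ofReal), 0 < z.re

/-- The operator `c ^ E = exp (E log c)` on `ℝ^d`, for `c > 0`. -/
def powOp {d : ℕ} (c : ℝ) (E : Matrix (Fin d) (Fin d) ℝ) : Space d →L[ℝ] Space d :=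
  Matrix.toEuclideanCLM (𝕜 := ℝ) (NormedSpace.exp (Real.log c • E))

/-- The norm `‖x‖₀ = ∫₀¹ ‖t ^ E x‖ dt / t` adapted to `E`. If the eigenvalues of `E` have positive
real parts, the integral is finite, `t ↦ ‖t ^ E x‖₀` is a strictly increasing bijection of
`(0, ∞)` for `x ≠ 0`, and `(r, θ) ↦ r ^ E θ` is a homeomorphism from `(0, ∞) × {‖θ‖₀ = 1}` onto
`ℝ^d \ {0}`. -/
def adaptedNorm {d : ℕ} (E : Matrix (Fin d) (Fin d) ℝ) (x : Space d) : ℝ :=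
  ∫ t in Set.Ioo (0 : ℝ) 1, ‖powOp t E x‖ / t

/-- The radial part `τ(x)` of `x` in the polar coordinates of `E`: for `x ≠ 0` it is the unique
`r > 0` with `‖r ^ (-E) x‖₀ = 1`, here written as the least `r > 0` with `‖r ^ (-E) x‖₀ ≤ 1`
(`r ↦ ‖r ^ (-E) x‖₀` decreases strictly and continuously from `∞` to `0`); and `τ(0) = 0`.
Note `r ^ (-E) = (1 / r) ^ E`. -/
def radialPart {d : ℕ} (E : Matrix (Fin d) (Fin d) ℝ) (x : Space d) : ℝ :=
  sInf {r : ℝ | 0 < r ∧ adaptedNorm E (powOp r⁻¹ E x) ≤ 1}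

/-- `φ` is `E`-homogeneous: `φ (c ^ E x) = c φ(x)` for all `c > 0` and `x ≠ 0`. -/
def IsHomogeneous {d : ℕ} (E : Matrix (Fin d) (Fin d) ℝ) (φ : Space d → ℝ) : Prop :=
  ∀ c : ℝ, 0 < c → ∀ x : Space d, x ≠ 0 → φ (powOp c E x) = c * φ x

/-- `φ : ℝ^d → [0, ∞)` is `(β, E)`-admissible. -/
structure IsAdmissible {d : ℕ} (β : ℝ) (E : Matrix (Fin d) (Fin d) ℝ) (φ : Space d → ℝ) :
    Prop where
  continuous : Continuous φ
  nonneg : ∀ x, 0 ≤ φ x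
  pos : ∀ x, x ≠ 0 → 0 < φ x
  bound : ∀ A B : ℝ, 0 < A → A < B → ∃ C : ℝ, 0 < C ∧ ∀ x y : Space d,
    A ≤ ‖y‖ → ‖y‖ ≤ B → radialPart E x ≤ 1 → |φ (x + y) - φ y| ≤ C * radialPart E x ^ β

/-- `Z` is an independently scattered symmetric `α`-stable random measure on `ℝ^d` with Lebesgue
control measure, on the probability space `(Ω, P)`. Only the values of `Z` at Borel sets of finite
Lebesgue measure matter. The countable sums converge almost surely as series; in general they
do not converge absolutely. -/
structure IsStableRandomMeasure {d : ℕ} {Ω : Type*} [MeasurableSpace Ω] (α : ℝ) (P : Measure Ω)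
    (Z : Set (Space d) → Ω → ℝ) : Prop where
  measurable : ∀ A, MeasurableSet A → volume A < ⊤ → Measurable (Z A)
  /-- `Z(A)` is symmetric `α`-stable with scale parameter `λ(A) ^ (1 / α)`. -/
  law : ∀ A, MeasurableSet A → volume A < ⊤ → ∀ t : ℝ,
    charFun (P.map (Z A)) t = (Real.exp (-(volume.real A * |t| ^ α)) : ℂ)
  indep : ∀ (n : ℕ) (A : Fin n → Set (Space d)), (∀ i, MeasurableSet (A i)) →
    (∀ i, volume (A i) < ⊤) → Pairwise (fun i j => Disjoint (A i) (A j)) →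
    iIndepFun (fun i => Z (A i)) P
  sigma_additive : ∀ A : ℕ → Set (Space d), (∀ i, MeasurableSet (A i)) →
    Pairwise (fun i j => Disjoint (A i) (A j)) → volume (⋃ i, A i) < ⊤ →
    ∀ᵐ ω ∂P, Tendsto (fun n => ∑ i ∈ Finset.range n, Z (A i) ω) atTop (𝓝 (Z (⋃ i, A i) ω))

/-- `∫ s dZ = ∑ a, a Z({s = a})` for a simple function `s` with support of finite measure (the term
`a = 0` contributes nothing). -/
def simpleIntegral {d : ℕ} {Ω : Type*} (Z : Set (Space d) → Ω → ℝ)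
    (s : SimpleFunc (Space d) ℝ) (ω : Ω) : ℝ :=
  ∑ a ∈ s.range, a * Z (s ⁻¹' {a}) ω

/-- The random variable `Y` is (a version of) `∫ f(y) Z(dy)`: `f` is in `L^α(ℝ^d)`, and `Y` is the
limit in probability of `∫ s_n dZ` for simple functions `s_n` of finite measure support that
converge to `f` in `L^α`. (The limit does not depend on the sequence, up to null events.) -/
def IsStableIntegral {d : ℕ} {Ω : Type*} [MeasurableSpace Ω] (α : ℝ) (P : Measure Ω)
    (Z : Set (Space d) → Ω → ℝ) (f : Space d → ℝ) (Y : Ω → ℝ) : Prop :=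
  Measurable Y ∧ MemLp f (ENNReal.ofReal α) volume ∧
    ∃ s : ℕ → SimpleFunc (Space d) ℝ,
      (∀ n, (s n).FinMeasSupp volume) ∧
      Tendsto (fun n => eLpNorm (fun y => s n y - f y) (ENNReal.ofReal α) volume) atTop (𝓝 0) ∧
      TendstoInMeasure P (fun n => simpleIntegral Z (s n)) atTop Y

/-- The kernel `y ↦ φ(x - y) ^ (H - q / α) - φ(-y) ^ (H - q / α)`, where `q = trace E`. -/
def maKernel {d : ℕ} (E : Matrix (Fin d) (Fin d) ℝ) (φ : Space d → ℝ) (α H : ℝ)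
    (x y : Space d) : ℝ :=
  φ (x - y) ^ (H - E.trace / α) - φ (-y) ^ (H - E.trace / α)

/-- `X` is (a version of) the moving-average random field
`X_φ(x) = ∫ (φ(x - y) ^ (H - q / α) - φ(-y) ^ (H - q / α)) Z(dy)`, `x ∈ ℝ^d`. -/
def IsMovingAverageField {d : ℕ} {Ω : Type*} [MeasurableSpace Ω]
    (E : Matrix (Fin d) (Fin d) ℝ) (φ : Space d → ℝ) (α H : ℝ) (P : Measure Ω)
    (Z : Set (Space d) → Ω → ℝ) (X : Space d → Ω → ℝ) : Prop :=
  ∀ x, IsStableIntegral α P Z (maKernel E φ α H x) (X x)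

/-- Two random fields on `ℝ^d` have the same finite-dimensional distributions. -/
def FddEq {d : ℕ} {Ω : Type*} [MeasurableSpace Ω] (P : Measure Ω) (X Y : Space d → Ω → ℝ) : Prop :=
  ∀ (m : ℕ) (x : Fin m → Space d),
    IdentDistrib (fun ω (j : Fin m) => X (x j) ω) (fun ω (j : Fin m) => Y (x j) ω) P P

/-- Operator scaling: `{X(c ^ E x)}` and `{c ^ H X(x)}` agree in law for all `c > 0`. -/
def IsOperatorScaling {d : ℕ} {Ω : Type*} [MeasurableSpace Ω] (P : Measure Ω)
    (E : Matrix (Fin d) (Fin d) ℝ) (H : ℝ) (X : Space d → Ω → ℝ) : Prop :=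
  ∀ c : ℝ, 0 < c → FddEq P (fun x => X (powOp c E x)) (fun x ω => c ^ H * X x ω)

/-- Stationary increments: `{X(x + h) - X(h)}` and `{X(x)}` agree in law for all `h`. -/
def HasStationaryIncrements {d : ℕ} {Ω : Type*} [MeasurableSpace Ω] (P : Measure Ω)
    (X : Space d → Ω → ℝ) : Prop :=
  ∀ h : Space d, FddEq P (fun x ω => X (x + h) ω - X h ω) X

end OperatorScaling

end

/-! A stable integral `∫ f dZ` has characteristic function `exp(-|t|^α ∫|f|^α)`. Since linear
combinations of such integrals are integrals of the combined kernels, the joint law of `X(x_1), …,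
X(x_m)` depends only on the numbers `∫|∑ θ_j k(x_j, y)|^α dy` (`fddEq_of_alphaMass_eq`). Both
invariances thus become changes of variables. Under `y ↦ c^E y` the Jacobian is `c^q` and the kernel
gains `c^(H - q/α)`, so the mass gains `c^q c^(Hα - q) = (c^H)^α`. An increment of the field has a
translated kernel, and Lebesgue measure is translation invariant.

Existence needs the kernel in `L^α` (`memLp_maKernel`). Put `γ = H - q/α`. The map `c^E` carries `{1
≤ φ ≤ 2}` to `{c ≤ φ ≤ 2c}`, so `∫ φ^p` over dyadic shells is a geometric series: it converges near
the origin when `p + q > 0` and at infinity when `p + q < 0`. Near the singularities `p = γα` and `p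
+ q = Hα > 0`. Far away, admissibility gains a factor `φ^(-β)` (`exists_kernel_bound`), so `p = (γ -
β)α` and `p + q = (H - β)α < 0`. Integrals of approximating simple functions are then Cauchy in
probability, and Borel–Cantelli gives a limit (`exists_isStableIntegral`). -/

noncomputable section

namespace OperatorScaling

section

variable {d : ℕ} {E : Matrix (Fin d) (Fin d) ℝ}

/-! ### Jacobi's formula for the determinant of a matrix exponential. -/

section Determinant

open scoped Matrix.Norms.Operator

theorem differentiable_det {n : ℕ} :
    Differentiable ℝ (fun A : Matrix (Fin n) (Fin n) ℝ => A.det) := by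
  have hentry : ∀ i j, Differentiable ℝ (fun A : Matrix (Fin n) (Fin n) ℝ => A i j) := fun i j =>
    (LinearMap.toContinuousLinearMap (Matrix.entryLinearMap ℝ ℝ i j)).differentiable
  simp only [Matrix.det_apply]
  fun_prop

/-- The curves `1 + sA` and `exp(sA)` have the same position and velocity at `s = 0`, so `det` has
the same derivative along both. Along the first it is read off from the polynomial `det(1 + sA)`,
and the differential of `det` is never computed. -/
theorem hasDerivAt_det_exp_smul_zero (A : Matrix (Fin d) (Fin d) ℝ) :
    HasDerivAt (fun s : ℝ => (NormedSpace.exp (s • A)).det) A.trace 0 := by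
  have hdet := (differentiable_det (n := d) 1).hasFDerivAt
  have h1 : HasDerivAt (fun s : ℝ => 1 + s • A) A 0 := by
    have := ((hasDerivAt_id (0 : ℝ)).smul_const A).const_add (1 : Matrix (Fin d) (Fin d) ℝ)
    rw [one_smul] at this
    exact this
  have h2 : HasDerivAt (fun s : ℝ => NormedSpace.exp (s • A)) A 0 := by
    have := hasDerivAt_exp_smul_const (𝕂 := ℝ) A (0 : ℝ)
    rw [zero_smul, NormedSpace.exp_zero, one_mul] at this
    exact this
  have e1 := HasFDerivAt.comp_hasDerivAt_of_eq (0 : ℝ) hdet h1 (by simp)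
  have e2 := HasFDerivAt.comp_hasDerivAt_of_eq (0 : ℝ) hdet h2 (by simp)
  have e3 : HasDerivAt (fun s : ℝ => (1 + s • A).det) A.trace 0 := by
    rw [funext fun s : ℝ => Matrix.det_one_add_smul s A]
    set p := (Matrix.det (1 + (Polynomial.X : Polynomial ℝ) • A.map Polynomial.C)).divX.divX
    have h := (((hasDerivAt_id (0 : ℝ)).const_mul A.trace).const_add 1).add
      ((p.hasDerivAt 0).mul ((hasDerivAt_id (0 : ℝ)).pow 2))
    simpa [Pi.add_def, Pi.mul_def] using h
  have := e1.unique e3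
  rw [this] at e2
  exact e2

end Determinant

/-- Multiplicativity in `s` carries the derivative at `0` to every `s`, giving `f' = f · trace A`;
hence `f(s) exp(-s trace A)` is constant. -/
theorem det_exp_smul (A : Matrix (Fin d) (Fin d) ℝ) (s : ℝ) :
    (NormedSpace.exp (s • A)).det = Real.exp (s * A.trace) := by
  have hadd : ∀ s t : ℝ, (NormedSpace.exp ((s + t) • A)).det
      = (NormedSpace.exp (s • A)).det * (NormedSpace.exp (t • A)).det := by
    intro s t
    rw [add_smul, Matrix.exp_add_of_commute _ _ (((Commute.refl A).smul_left s).smul_right t),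
      Matrix.det_mul]
  have hderiv : ∀ s : ℝ, HasDerivAt (fun s : ℝ => (NormedSpace.exp (s • A)).det)
      ((NormedSpace.exp (s • A)).det * A.trace) s := by
    intro s
    have h0 := hasDerivAt_det_exp_smul_zero A
    have h1 : HasDerivAt (fun t : ℝ => t - s) 1 s := (hasDerivAt_id s).sub_const s
    have h2 := (HasDerivAt.comp_of_eq s h0 h1 (by simp)).const_mul (NormedSpace.exp (s • A)).det
    rw [mul_one] at h2
    refine h2.congr_of_eventuallyEq (Eventually.of_forall fun t => ?_)
    simp only [Function.comp]
    rw [← hadd]; congr 3; ring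
  have hconst : ∀ s : ℝ, HasDerivAt (fun s : ℝ => (NormedSpace.exp (s • A)).det *
      Real.exp (-(s * A.trace))) 0 s := by
    intro s
    have h1 : HasDerivAt (fun s : ℝ => Real.exp (-(s * A.trace)))
        (Real.exp (-(s * A.trace)) * -(1 * A.trace)) s :=
      (((hasDerivAt_id s).mul_const A.trace).neg).exp
    have h2 := (hderiv s).mul h1
    have h3 : (NormedSpace.exp (s • A)).det * A.trace * Real.exp (-(s * A.trace)) +
        (NormedSpace.exp (s • A)).det * (Real.exp (-(s * A.trace)) * -(1 * A.trace)) = 0 := by ring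
    rw [h3] at h2
    exact h2
  have := is_const_of_deriv_eq_zero (fun s => (hconst s).differentiableAt)
    (fun s => (hconst s).deriv) s 0
  simp only [zero_smul, NormedSpace.exp_zero, Matrix.det_one, zero_mul, neg_zero, Real.exp_zero,
    mul_one] at this
  rw [Real.exp_neg] at this
  field_simp at this
  exact this

/-! ### The operators `c^E`: group law, continuity, Jacobian. -/

theorem powOp_eq_exp (c : ℝ) (E : Matrix (Fin d) (Fin d) ℝ) :
    powOp c E = NormedSpace.exp (Real.log c • Matrix.toEuclideanCLM (𝕜 := ℝ) E) := by
  have hcont : Continuous (Matrix.toEuclideanCLM (n := Fin d) (𝕜 := ℝ)) :=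
    LinearMap.continuous_of_finiteDimensional
      (Matrix.toEuclideanCLM (n := Fin d) (𝕜 := ℝ)).toAlgEquiv.toLinearMap
  rw [powOp, ← map_smul]
  open scoped Matrix.Norms.Operator in
  exact NormedSpace.map_exp (Matrix.toEuclideanCLM (n := Fin d) (𝕜 := ℝ)) hcont _

theorem powOp_mul {a b : ℝ} (ha : 0 < a) (hb : 0 < b) (x : Space d) :
    powOp (a * b) E x = powOp a E (powOp b E x) := by
  simp only [powOp]
  rw [Real.log_mul ha.ne' hb.ne', add_smul, Matrix.exp_add_of_commute _ _
    (((Commute.refl E).smul_left _).smul_right _), map_mul]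
  rfl

theorem powOp_one (x : Space d) : powOp 1 E x = x := by
  simp [powOp]

theorem powOp_inv_powOp {c : ℝ} (hc : 0 < c) (x : Space d) : powOp c⁻¹ E (powOp c E x) = x := by
  rw [← powOp_mul (inv_pos.2 hc) hc, inv_mul_cancel₀ hc.ne', powOp_one]

theorem powOp_powOp_inv {c : ℝ} (hc : 0 < c) (x : Space d) : powOp c E (powOp c⁻¹ E x) = x := by
  rw [← powOp_mul hc (inv_pos.2 hc), mul_inv_cancel₀ hc.ne', powOp_one]

theorem continuousOn_powOp (E : Matrix (Fin d) (Fin d) ℝ) :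
    ContinuousOn (fun c => powOp c E) (Set.Ioi 0) := by
  simp only [powOp_eq_exp]
  let _ : NormedAlgebra ℚ (Space d →L[ℝ] Space d) := NormedAlgebra.restrictScalars ℚ ℝ _
  refine NormedSpace.exp_continuous.comp_continuousOn ?_
  refine ContinuousOn.smul (Real.continuousOn_log.mono fun x hx => (ne_of_gt hx)) ?_
  exact continuousOn_const

theorem det_powOp {c : ℝ} (hc : 0 < c) (E : Matrix (Fin d) (Fin d) ℝ) :
    LinearMap.det (powOp c E : Space d →ₗ[ℝ] Space d) = c ^ E.trace := by
  rw [powOp, Matrix.coe_toEuclideanCLM_eq_toEuclideanLin, Matrix.toEuclideanLin, Matrix.toLpLin_eq_toLin,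
    LinearMap.det_toLin, det_exp_smul, Real.rpow_def_of_pos hc]

theorem map_powOp_volume {c : ℝ} (hc : 0 < c) (E : Matrix (Fin d) (Fin d) ℝ) :
    Measure.map (powOp c E) (volume : Measure (Space d))
      = ENNReal.ofReal (c ^ (-E.trace)) • volume := by
  have hpos : 0 < c ^ E.trace := Real.rpow_pos_of_pos hc _
  have h := Measure.map_linearMap_addHaar_eq_smul_addHaar (volume : Measure (Space d))
    (f := (powOp c E : Space d →ₗ[ℝ] Space d)) (by rw [det_powOp hc]; exact hpos.ne')
  rw [det_powOp hc, abs_of_pos (inv_pos.2 hpos), ← Real.rpow_neg hc.le] at h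
  exact h

/-! ### Decay of `c^E` as `c → 0`. -/

section Contraction

open scoped Matrix.Norms.Operator

/-- Write `A = z + N`, where a power of `N` kills `v`. The exponential series of `-sN` at `v` is a
polynomial in `s`, and the factor `exp(-sz)` beats it because `Re z > 0`. -/
theorem tendsto_exp_smul_mulVec_of_mem_maxGenEigenspace (A : Matrix (Fin d) (Fin d) ℂ) {z : ℂ}
    (hz : 0 < z.re) {v : Fin d → ℂ} (hv : v ∈ Module.End.maxGenEigenspace (Matrix.toLin' A) z) :
    Tendsto (fun s : ℝ => (NormedSpace.exp ((-s : ℂ) • A)).mulVec v) atTop (𝓝 0) := by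
  obtain ⟨k, hk⟩ := Module.End.mem_maxGenEigenspace _ _ _ |>.1 hv
  set N : Matrix (Fin d) (Fin d) ℂ := A - z • 1 with hN
  have hNv : ∀ j, k ≤ j → (N ^ j).mulVec v = 0 := by
    intro j hj
    have : (N ^ k).mulVec v = 0 := by
      rw [← hk, ← Matrix.toLin'_apply, Matrix.toLin'_pow, hN, map_sub, map_smul, Matrix.toLin'_one]
      rfl
    rw [← Nat.sub_add_cancel hj, pow_add, ← Matrix.mulVec_mulVec, this, Matrix.mulVec_zero]
  have hsum : ∀ s : ℝ, (NormedSpace.exp ((-s : ℂ) • N)).mulVec v =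
      ∑ j ∈ Finset.range k, (((j.factorial : ℂ)⁻¹) * (-s : ℂ) ^ j) • (N ^ j).mulVec v := by
    intro s
    have h := NormedSpace.exp_series_hasSum_exp' (𝕂 := ℂ) ((-s : ℂ) • N)
    have hcont : Continuous (fun M : Matrix (Fin d) (Fin d) ℂ => M.mulVec v) := by fun_prop
    have h2 := h.map ((Matrix.mulVecBilin ℂ ℂ).flip v) hcont
    have h3 := hasSum_sum_of_ne_finset_zero (L := SummationFilter.unconditional ℕ)
      (s := Finset.range k)
      (f := (fun j : ℕ => ((j.factorial : ℂ)⁻¹ • ((-s : ℂ) • N) ^ j).mulVec v)) (by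
        intro j hj
        rw [smul_pow, Matrix.smul_mulVec, Matrix.smul_mulVec, hNv j (by simpa using hj)]
        simp)
    refine (h2.unique h3).trans (Finset.sum_congr rfl fun j _ => ?_)
    rw [smul_pow, Matrix.smul_mulVec, Matrix.smul_mulVec, smul_smul]
  have hexp : ∀ s : ℝ, NormedSpace.exp ((-s : ℂ) • A)
      = Complex.exp (-s * z) • NormedSpace.exp ((-s : ℂ) • N) := by
    intro s
    have : (-s : ℂ) • A = algebraMap ℂ (Matrix (Fin d) (Fin d) ℂ) (-s * z) + (-s : ℂ) • N := by
      rw [hN, Algebra.algebraMap_eq_smul_one, smul_sub, smul_smul]; abel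
    have hscalar : NormedSpace.exp (algebraMap ℂ (Matrix (Fin d) (Fin d) ℂ) (-s * z))
        = algebraMap ℂ _ (Complex.exp (-s * z)) := by
      rw [Complex.exp_eq_exp_ℂ]
      exact (NormedSpace.algebraMap_exp_comm _).symm
    rw [this, Matrix.exp_add_of_commute _ _ (Algebra.commute_algebraMap_left _ _), hscalar, Algebra.algebraMap_eq_smul_one, smul_mul_assoc, one_mul]
  have hterm : ∀ j : ℕ, Tendsto (fun s : ℝ => Complex.exp (-s * z) * (((j.factorial : ℂ)⁻¹) *
      (-s : ℂ) ^ j)) atTop (𝓝 0) := by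
    intro j
    rw [tendsto_zero_iff_norm_tendsto_zero]
    have h := ((isLittleO_pow_exp_pos_mul_atTop j hz).tendsto_div_nhds_zero).const_mul
      ((j.factorial : ℝ)⁻¹)
    rw [mul_zero] at h
    refine h.congr' ?_
    filter_upwards [eventually_ge_atTop 0] with s hs
    simp only [norm_mul, norm_inv, norm_pow, norm_neg, Complex.norm_real, Complex.norm_natCast,
      Complex.norm_exp, Real.norm_of_nonneg hs]
    have : (-(s : ℂ) * z).re = -(z.re * s) := by simp [mul_comm]
    rw [this, Real.exp_neg]
    field_simp
  have := tendsto_finsetSum (Finset.range k) (fun j _ => (hterm j).smul_const ((N ^ j).mulVec v))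
  simp only [zero_smul, Finset.sum_const_zero] at this
  refine this.congr fun s => ?_
  rw [hexp, Matrix.smul_mulVec, hsum, Finset.smul_sum]
  simp only [smul_smul]

theorem tendsto_exp_smul_mulVec (A : Matrix (Fin d) (Fin d) ℂ)
    (hA : ∀ z ∈ spectrum ℂ A, 0 < z.re) (v : Fin d → ℂ) :
    Tendsto (fun s : ℝ => (NormedSpace.exp ((-s : ℂ) • A)).mulVec v) atTop (𝓝 0) := by
  have hv : v ∈ ⨆ z, Module.End.maxGenEigenspace (Matrix.toLin' A) z := by
    rw [Module.End.iSup_maxGenEigenspace_eq_top]; trivial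
  refine Submodule.iSup_induction _ (motive := fun v => Tendsto (fun s : ℝ =>
    (NormedSpace.exp ((-s : ℂ) • A)).mulVec v) atTop (𝓝 0)) hv ?_ ?_ ?_
  · intro z w hw
    -- The supremum runs over all complex `z`; those that are not eigenvalues contribute only the
    -- zero vector.
    by_cases hz : Module.End.HasEigenvalue (Matrix.toLin' A) z
    · refine tendsto_exp_smul_mulVec_of_mem_maxGenEigenspace A (hA z ?_) hw
      have := hz.mem_spectrum
      rwa [Matrix.spectrum_toLin'] at this
    · have : w = 0 := by
        by_contra hne
        apply hz
        have h : Module.End.HasUnifEigenvalue (Matrix.toLin' A) z ⊤ :=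
          (Submodule.ne_bot_iff _).2 ⟨w, hw, hne⟩
        exact h.lt one_pos
      simp [this]
  · simp
  · intro x y hx hy
    simpa [Matrix.mulVec_add] using hx.add hy

theorem exp_map_ofReal (A : Matrix (Fin d) (Fin d) ℝ) :
    (NormedSpace.exp A).map Complex.ofReal = NormedSpace.exp (A.map Complex.ofReal) := by
  have hcont : Continuous (Complex.ofRealHom.mapMatrix : Matrix (Fin d) (Fin d) ℝ →+* _) := by
    exact Continuous.matrix_map continuous_id Complex.continuous_ofReal
  exact NormedSpace.map_exp (Complex.ofRealHom.mapMatrix) hcont A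

theorem tendsto_exp_neg_smul (hE : HasPositiveSpectrum E) :
    Tendsto (fun s : ℝ => NormedSpace.exp ((-s) • E)) atTop (𝓝 0) := by
  refine tendsto_pi_nhds.2 fun i => tendsto_pi_nhds.2 fun j => ?_
  have h := tendsto_pi_nhds.1 (tendsto_exp_smul_mulVec _ hE (Pi.single j 1)) i
  have h2 := (Complex.continuous_re.tendsto _).comp h
  simp only [Pi.zero_apply, Complex.zero_re] at h2
  refine h2.congr fun s => ?_
  have : (-s : ℂ) • E.map Complex.ofReal = ((-s) • E).map Complex.ofReal := by
    ext; simp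
  simp only [Function.comp]
  rw [this, ← exp_map_ofReal]
  simp

end Contraction

theorem tendsto_powOp_zero (hE : HasPositiveSpectrum E) :
    Tendsto (fun c => powOp c E) (𝓝[>] 0) (𝓝 0) := by
  have hcont : Continuous (Matrix.toEuclideanCLM (n := Fin d) (𝕜 := ℝ)) :=
    LinearMap.continuous_of_finiteDimensional
      (Matrix.toEuclideanCLM (n := Fin d) (𝕜 := ℝ)).toAlgEquiv.toLinearMap
  have h1 : Tendsto (fun c => -Real.log c) (𝓝[>] 0) atTop :=
    tendsto_neg_atBot_atTop.comp Real.tendsto_log_nhdsGT_zero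
  have h2 := (hcont.tendsto 0).comp ((tendsto_exp_neg_smul hE).comp h1)
  rw [map_zero] at h2
  refine h2.congr fun c => ?_
  simp [powOp]

end

/-! ### Scaling of `τ` and `φ`; boundedness of the sublevel sets of `φ`. -/

section

variable {d : ℕ} {E : Matrix (Fin d) (Fin d) ℝ} {φ : Space d → ℝ}

/-- Since `r^(-E) c^E = (r/c)^(-E)`, the set defining the infimum is dilated by `c`. This and
nonnegativity are all that the proof uses about `τ`. -/
theorem radialPart_powOp {c : ℝ} (hc : 0 < c) (x : Space d) :
    radialPart E (powOp c E x) = c * radialPart E x := by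
  unfold radialPart
  rw [← smul_eq_mul, ← Real.sInf_smul_of_nonneg hc.le]
  congr 1
  ext r
  rw [Set.mem_smul_set_iff_inv_smul_mem₀ hc.ne']
  simp only [Set.mem_ofPred_eq, smul_eq_mul]
  have hiff : 0 < c⁻¹ * r ↔ 0 < r := by
    rw [mul_pos_iff_of_pos_left (inv_pos.2 hc)]
  rw [hiff]
  refine and_congr_right fun hr => ?_
  rw [← powOp_mul (inv_pos.2 hr) hc, mul_inv, inv_inv, mul_comm]

theorem radialPart_nonneg (x : Space d) : 0 ≤ radialPart E x :=
  Real.sInf_nonneg fun _ hr => hr.1.le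

section Homogeneous

variable (hE : HasPositiveSpectrum E)
include hE

theorem tendsto_powOp_apply_zero (x : Space d) :
    Tendsto (fun c => powOp c E x) (𝓝[>] 0) (𝓝 0) := by
  have h := (ContinuousLinearMap.apply ℝ (Space d) x).continuous.tendsto 0
  rw [map_zero] at h
  exact h.comp (tendsto_powOp_zero hE)

/-- Homogeneity is only assumed off the origin; the value at `0` is forced by continuity along `c^E
x → 0`, which takes a nonzero `x`. -/
theorem homogeneous_zero [Nontrivial (Space d)] (hφ : IsHomogeneous E φ) (hcont : Continuous φ) :
    φ 0 = 0 := by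
  obtain ⟨x, hx⟩ := exists_ne (0 : Space d)
  have h1 := (hcont.tendsto 0).comp (tendsto_powOp_apply_zero hE x)
  have h2 : Tendsto (fun c : ℝ => c * φ x) (𝓝[>] 0) (𝓝 0) := by
    have : Tendsto (fun c : ℝ => c * φ x) (𝓝 0) (𝓝 (0 * φ x)) :=
      (continuous_id.mul continuous_const).tendsto 0
    rw [zero_mul] at this
    exact this.mono_left nhdsWithin_le_nhds
  refine tendsto_nhds_unique h1 (h2.congr' ?_)
  filter_upwards [self_mem_nhdsWithin] with c hc
  exact (hφ c hc x hx).symm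

theorem homogeneous_powOp [Nontrivial (Space d)] (hφ : IsHomogeneous E φ) (hcont : Continuous φ)
    {c : ℝ} (hc : 0 < c) (x : Space d) : φ (powOp c E x) = c * φ x := by
  by_cases hx : x = 0
  · simp [hx, homogeneous_zero hE hφ hcont]
  · exact hφ c hc x hx

theorem exists_norm_powOp_eq_one {x : Space d} (hx : x ≠ 0) :
    ∃ c : ℝ, 0 < c ∧ ‖powOp c E x‖ = 1 := by
  have hcont : ContinuousOn (fun c => ‖powOp c E x‖) (Set.Ioi 0) :=
    ((continuousOn_powOp E).clm_apply continuousOn_const).norm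
  have hxpos : 0 < ‖x‖ := norm_pos_iff.2 hx
  obtain ⟨a, ha1, ha0⟩ : ∃ a : ℝ, ‖powOp a E x‖ < 1 ∧ a ∈ Set.Ioi (0 : ℝ) := by
    have h := (tendsto_powOp_apply_zero hE x).norm
    rw [norm_zero] at h
    exact ((h.eventually (gt_mem_nhds one_pos)).and self_mem_nhdsWithin).exists
  -- From `‖x‖ ≤ ‖s^E‖ ‖s^(-E) x‖` and `‖s^E‖ < ‖x‖`, the orbit has norm at least `1` at `s⁻¹`; the
  -- intermediate value theorem applies between `a` and `s⁻¹`.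
  obtain ⟨s, hs1, hs0⟩ : ∃ s : ℝ, ‖powOp s E‖ < ‖x‖ ∧ s ∈ Set.Ioi (0 : ℝ) := by
    have h := (tendsto_powOp_zero hE).norm
    rw [norm_zero] at h
    exact ((h.eventually (gt_mem_nhds hxpos)).and self_mem_nhdsWithin).exists
  have hs0' : 0 < s := hs0
  have hb : 1 ≤ ‖powOp s⁻¹ E x‖ := by
    by_contra! hlt
    have h1 := (powOp s E).le_opNorm (powOp s⁻¹ E x)
    rw [powOp_powOp_inv hs0'] at h1
    nlinarith [norm_nonneg (powOp s E), norm_nonneg (powOp s⁻¹ E x)]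
  obtain ⟨c, hc, hc1⟩ := isPreconnected_Ioi.intermediate_value ha0 (inv_pos.2 hs0') hcont
    ⟨ha1.le, hb⟩
  exact ⟨c, hc, hc1⟩

theorem exists_norm_powOp_le (R : ℝ) : ∃ M : ℝ, ∀ s, 0 < s → s ≤ R → ‖powOp s E‖ ≤ M := by
  have h := (tendsto_powOp_zero hE).norm
  rw [norm_zero] at h
  obtain ⟨δ, hδ, hδ'⟩ := mem_nhdsGT_iff_exists_Ioo_subset.1 (h.eventually (gt_mem_nhds one_pos))
  have hδ0 : 0 < δ := hδ
  obtain ⟨M, hM⟩ := (isCompact_Icc (a := δ) (b := R)).exists_bound_of_continuousOn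
    ((continuousOn_powOp E).mono fun s hs => hδ0.trans_le hs.1)
  refine ⟨max 1 M, fun s hs hsR => ?_⟩
  rcases lt_or_ge s δ with hlt | hge
  · exact le_max_of_le_left (le_of_lt (hδ' ⟨hs, hlt⟩))
  · exact le_max_of_le_right (hM s ⟨hge, hsR⟩)

/-- Move `x` to the Euclidean unit sphere by some `c^E`. There `φ` is at least its positive minimum,
so `c⁻¹` is bounded, and `x` is the image of a unit vector under `(c⁻¹)^E`, whose norm is bounded
for bounded `c⁻¹`. -/
theorem exists_norm_le_of_homogeneous_le [Nontrivial (Space d)] (hφ : IsHomogeneous E φ)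
    (hcont : Continuous φ) (hpos : ∀ x, x ≠ 0 → 0 < φ x) (R : ℝ) :
    ∃ M : ℝ, ∀ x, φ x ≤ R → ‖x‖ ≤ M := by
  have hne : (Metric.sphere (0 : Space d) 1).Nonempty :=
    NormedSpace.sphere_nonempty.2 zero_le_one
  obtain ⟨u, hu, hmin⟩ := (isCompact_sphere (0 : Space d) 1).exists_isMinOn hne hcont.continuousOn
  have hm : 0 < φ u := hpos u (by
    rintro rfl
    simp at hu)
  obtain ⟨M, hM⟩ := exists_norm_powOp_le hE (R / φ u)
  refine ⟨max M 0, fun x hxR => ?_⟩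
  by_cases hx : x = 0
  · simp [hx]
  obtain ⟨c, hc, hc1⟩ := exists_norm_powOp_eq_one hE hx
  have h1 : φ u ≤ φ (powOp c E x) := hmin (by simpa using hc1)
  rw [hφ c hc x hx] at h1
  have h2 : c⁻¹ ≤ R / φ u := by
    rw [le_div_iff₀ hm, inv_mul_le_iff₀ hc]
    exact h1.trans (mul_le_mul_of_nonneg_left hxR hc.le)
  have h3 := (powOp c⁻¹ E).le_opNorm (powOp c E x)
  rw [powOp_inv_powOp hc, hc1, mul_one] at h3
  exact le_max_of_le_left (h3.trans (hM _ (inv_pos.2 hc) h2))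

end Homogeneous

theorem lintegral_comp_powOp {c : ℝ} (hc : 0 < c) (E : Matrix (Fin d) (Fin d) ℝ)
    {g : Space d → ENNReal} (hg : Measurable g) :
    ∫⁻ y, g (powOp c E y) = ENNReal.ofReal (c ^ (-E.trace)) * ∫⁻ y, g y := by
  rw [← lintegral_map hg (powOp c E).continuous.measurable, map_powOp_volume hc,
    lintegral_smul_measure, smul_eq_mul]

/-! ### Integrals of powers of `φ` over dyadic shells. -/

section Integrability

variable [Nontrivial (Space d)] (hE : HasPositiveSpectrum E) (hφ : IsHomogeneous E φ)
  (hcont : Continuous φ) (hpos : ∀ x, x ≠ 0 → 0 < φ x)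

include hE hφ hcont hpos

/-- Substituting `c^E y` gives a factor `c^p` from homogeneity and `c^q` from the Jacobian. -/
theorem setLIntegral_shell (p : ℝ) {c : ℝ} (hc : 0 < c) :
    ∫⁻ y in {y | c ≤ φ y ∧ φ y ≤ 2 * c}, ENNReal.ofReal (φ y ^ p) =
      ENNReal.ofReal (c ^ (p + E.trace)) *
        ∫⁻ y in {y | 1 ≤ φ y ∧ φ y ≤ 2}, ENNReal.ofReal (φ y ^ p) := by
  have hmeas : ∀ a b : ℝ, MeasurableSet {y | a ≤ φ y ∧ φ y ≤ b} := fun a b =>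
    (measurableSet_le measurable_const hcont.measurable).inter
      (measurableSet_le hcont.measurable measurable_const)
  have hφp : Measurable fun y => ENNReal.ofReal (φ y ^ p) :=
    (hcont.measurable.pow_const p).ennreal_ofReal
  rw [← lintegral_indicator (hmeas _ _), ← lintegral_indicator (hmeas _ _)]
  have h := lintegral_comp_powOp hc E (hφp.indicator (hmeas c (2 * c)))
  have hnn : ∀ y, 0 ≤ φ y := fun y => by
    by_cases hy : y = 0
    · rw [hy, homogeneous_zero hE hφ hcont]
    · exact (hpos y hy).le
  have hind : ∀ y, Set.indicator {y | c ≤ φ y ∧ φ y ≤ 2 * c}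
      (fun y => ENNReal.ofReal (φ y ^ p)) (powOp c E y) = ENNReal.ofReal (c ^ p) *
        Set.indicator {y | 1 ≤ φ y ∧ φ y ≤ 2} (fun y => ENNReal.ofReal (φ y ^ p)) y := by
    intro y
    simp only [Set.indicator_apply, Set.mem_ofPred_eq, homogeneous_powOp hE hφ hcont hc]
    have h1 : c ≤ c * φ y ↔ 1 ≤ φ y := by
      constructor <;> intro h <;> nlinarith
    have h2 : c * φ y ≤ 2 * c ↔ φ y ≤ 2 := by
      constructor <;> intro h <;> nlinarith
    simp only [h1, h2]
    split_ifs
    · rw [Real.mul_rpow hc.le (hnn y), ENNReal.ofReal_mul (by positivity)]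
    · simp
  simp only [hind] at h
  rw [lintegral_const_mul _ (hφp.indicator (hmeas 1 2))] at h
  have hq : ENNReal.ofReal (c ^ (p + E.trace)) =
      ENNReal.ofReal (c ^ E.trace) * ENNReal.ofReal (c ^ p) := by
    rw [← ENNReal.ofReal_mul (by positivity), ← Real.rpow_add hc, add_comm]
  rw [hq, mul_assoc, h, ← mul_assoc, ← ENNReal.ofReal_mul (by positivity), ← Real.rpow_add hc]
  simp

theorem setLIntegral_unit_shell_lt_top (p : ℝ) :
    ∫⁻ y in {y | 1 ≤ φ y ∧ φ y ≤ 2}, ENNReal.ofReal (φ y ^ p) < ⊤ := by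
  obtain ⟨M, hM⟩ := exists_norm_le_of_homogeneous_le hE hφ hcont hpos 2
  have hvol : volume {y | 1 ≤ φ y ∧ φ y ≤ 2} < ⊤ :=
    (measure_mono (fun y hy => by simpa using hM y hy.2)).trans_lt
      (measure_closedBall_lt_top (x := (0 : Space d)) (r := M))
  refine (setLIntegral_lt_top_of_le_nnreal hvol.ne ⟨Real.toNNReal (2 ^ |p|), fun y hy => ?_⟩)
  refine ENNReal.ofReal_le_ofReal ?_
  calc φ y ^ p ≤ φ y ^ |p| := Real.rpow_le_rpow_of_exponent_le hy.1 (le_abs_self p)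
    _ ≤ 2 ^ |p| := Real.rpow_le_rpow (zero_le_one.trans hy.1) hy.2 (abs_nonneg p)

/-- The shells contribute a geometric series of ratio `b^(p+q)`; `b = 1/2` serves near the origin
and `b = 2` at infinity. -/
theorem setLIntegral_iUnion_shell_lt_top {p b R : ℝ} (hb : 0 < b) (hR : 0 < R)
    (hlt : b ^ (p + E.trace) < 1) :
    ∫⁻ y in ⋃ k : ℕ, {y | R * b ^ k ≤ φ y ∧ φ y ≤ 2 * (R * b ^ k)},
      ENNReal.ofReal (φ y ^ p) < ⊤ := by
  refine (lintegral_iUnion_le _ _).trans_lt ?_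
  have hterm : ∀ k : ℕ, ENNReal.ofReal ((R * b ^ k) ^ (p + E.trace)) =
      ENNReal.ofReal (R ^ (p + E.trace)) * ENNReal.ofReal (b ^ (p + E.trace)) ^ k := by
    intro k
    rw [Real.mul_rpow hR.le (by positivity), ENNReal.ofReal_mul (by positivity),
      ← ENNReal.ofReal_pow (by positivity), ← Real.rpow_natCast, ← Real.rpow_natCast,
      ← Real.rpow_mul hb.le, ← Real.rpow_mul hb.le, mul_comm (k : ℝ)]
  simp only [setLIntegral_shell hE hφ hcont hpos p (mul_pos hR (pow_pos hb _)), hterm]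
  rw [ENNReal.tsum_mul_right, ENNReal.tsum_mul_left, ENNReal.tsum_geometric]
  refine ENNReal.mul_lt_top (ENNReal.mul_lt_top ENNReal.ofReal_lt_top ?_)
    (setLIntegral_unit_shell_lt_top hE hφ hcont hpos p)
  rw [ENNReal.inv_lt_top, tsub_pos_iff_lt]
  simpa using hlt

theorem setLIntegral_sublevel_lt_top {p : ℝ} (hp : 0 < p + E.trace) {T : ℝ} (hT : 0 < T) :
    ∫⁻ y in {y | φ y < T}, ENNReal.ofReal (φ y ^ p) < ⊤ := by
  -- The origin lies in no shell and is a null set. The first shell starts at `T / 2` because each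
  -- shell reaches up to twice its base height.
  have hsub : {y | φ y < T} ⊆
      {0} ∪ ⋃ k : ℕ, {y | T / 2 * (1 / 2) ^ k ≤ φ y ∧ φ y ≤ 2 * (T / 2 * (1 / 2) ^ k)} := by
    intro y hy
    by_cases hy0 : y = 0
    · exact Or.inl hy0
    · refine Or.inr (Set.mem_iUnion.2 ?_)
      have hy' : φ y < T := hy
      obtain ⟨n, h1, h2⟩ := exists_nat_pow_near_of_lt_one (x := φ y / T) (y := (1 / 2 : ℝ))
        (div_pos (hpos y hy0) hT) ((div_le_one hT).2 hy'.le) (by norm_num) (by norm_num)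
      rw [lt_div_iff₀ hT, pow_succ] at h1
      rw [div_le_iff₀ hT] at h2
      exact ⟨n, by linarith, by linarith⟩
  refine (lintegral_mono_set hsub).trans_lt ((lintegral_union_le _ _ _).trans_lt ?_)
  have h0 : ∫⁻ y in ({0} : Set (Space d)), ENNReal.ofReal (φ y ^ p) = 0 :=
    setLIntegral_measure_zero _ _ (measure_singleton _)
  rw [h0, zero_add]
  exact setLIntegral_iUnion_shell_lt_top hE hφ hcont hpos (by norm_num) (by positivity)
    (Real.rpow_lt_one (by norm_num) (by norm_num) hp)

theorem setLIntegral_superlevel_lt_top {p : ℝ} (hp : p + E.trace < 0) {T : ℝ} (hT : 0 < T) :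
    ∫⁻ y in {y | T ≤ φ y}, ENNReal.ofReal (φ y ^ p) < ⊤ := by
  have hsub : {y | T ≤ φ y} ⊆
      ⋃ k : ℕ, {y | T * 2 ^ k ≤ φ y ∧ φ y ≤ 2 * (T * 2 ^ k)} := by
    intro y hy
    have hy' : T ≤ φ y := hy
    obtain ⟨n, h1, h2⟩ := exists_nat_pow_near (x := φ y / T) (y := (2 : ℝ))
      ((one_le_div hT).2 hy') (by norm_num)
    rw [le_div_iff₀ hT] at h1
    rw [div_lt_iff₀ hT, pow_succ] at h2
    exact Set.mem_iUnion.2 ⟨n, by linarith, by linarith⟩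
  refine (lintegral_mono_set hsub).trans_lt ?_
  exact setLIntegral_iUnion_shell_lt_top hE hφ hcont hpos (by norm_num) hT
    (Real.rpow_lt_one_of_one_lt_of_neg (by norm_num) hp)

end Integrability

/-! ### The moving-average kernel belongs to `L^α`. -/

theorem exists_abs_rpow_sub_one_le (γ : ℝ) :
    ∃ L : ℝ, 0 ≤ L ∧ ∀ u : ℝ, |u - 1| ≤ 1 / 2 → |u ^ γ - 1| ≤ L * |u - 1| := by
  have hcont : ContinuousOn (fun u : ℝ => γ * u ^ (γ - 1)) (Set.Icc (1 / 2) (3 / 2)) :=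
    continuousOn_const.mul (continuousOn_id.rpow_const fun u hu =>
      Or.inl (ne_of_gt (lt_of_lt_of_le (by norm_num) hu.1)))
  obtain ⟨L, hL⟩ := (isCompact_Icc (a := (1 / 2 : ℝ)) (b := 3 / 2)).exists_bound_of_continuousOn
    hcont
  have hone : (1 : ℝ) ∈ Set.Icc (1 / 2 : ℝ) (3 / 2) := by constructor <;> norm_num
  refine ⟨L, (norm_nonneg _).trans (hL 1 hone), fun u hu => ?_⟩
  rw [abs_le] at hu
  have h := (convex_Icc (1 / 2 : ℝ) (3 / 2)).norm_image_sub_le_of_norm_hasDerivWithin_le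
    (f := fun u : ℝ => u ^ γ) (f' := fun u : ℝ => γ * u ^ (γ - 1)) (C := L)
    (fun v hv => (Real.hasDerivAt_rpow_const
      (Or.inl (ne_of_gt (lt_of_lt_of_le (by norm_num) hv.1)))).hasDerivWithinAt) hL hone
    (y := u) ⟨by linarith, by linarith⟩
  simpa using h

theorem abs_sub_rpow_le {a b α : ℝ} (ha : 0 ≤ a) (hb : 0 ≤ b) (hα : 0 ≤ α) :
    |a - b| ^ α ≤ a ^ α + b ^ α := by
  have ha' := Real.rpow_nonneg ha α
  have hb' := Real.rpow_nonneg hb α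
  rcases le_total a b with h | h
  · calc |a - b| ^ α ≤ b ^ α :=
        Real.rpow_le_rpow (abs_nonneg _) (by rw [abs_le]; constructor <;> linarith) hα
      _ ≤ _ := by linarith
  · calc |a - b| ^ α ≤ a ^ α :=
        Real.rpow_le_rpow (abs_nonneg _) (by rw [abs_le]; constructor <;> linarith) hα
      _ ≤ _ := by linarith

/-- This supplies the annulus on which admissibility is applied. -/
theorem exists_norm_between_of_homogeneous_eq_one [Nontrivial (Space d)]
    (hE : HasPositiveSpectrum E) (hφ : IsHomogeneous E φ) (hcont : Continuous φ)
    (hpos : ∀ x, x ≠ 0 → 0 < φ x) :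
    ∃ A B : ℝ, 0 < A ∧ A < B ∧ ∀ x, φ x = 1 → A ≤ ‖x‖ ∧ ‖x‖ ≤ B := by
  obtain ⟨M, hM⟩ := exists_norm_le_of_homogeneous_le hE hφ hcont hpos 1
  have h0 : ∀ᶠ x in 𝓝 (0 : Space d), φ x < 1 :=
    hcont.continuousAt.eventually_lt continuousAt_const (by
      rw [homogeneous_zero hE hφ hcont]; exact one_pos)
  obtain ⟨A, hA, hA'⟩ := Metric.eventually_nhds_iff.1 h0
  refine ⟨A, max M (A + 1), hA, lt_max_of_lt_right (by linarith), fun x hx => ⟨?_, ?_⟩⟩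
  · by_contra! hlt
    exact (hA' (by simpa using hlt)).ne hx
  · exact le_max_of_le_left (hM x hx.le)

/-- With `c = φ(w)`, the point `c^(-E) w` lies on `{φ = 1}` and `φ(x + w) = c u` with `u = φ(c^(-E)x
+ c^(-E)w)`. Admissibility gives `|u - 1| ≤ C (τ(x)/c)^β`, and `u ↦ u^γ` is Lipschitz near `1`, so
the difference is `c^γ · O(c^(-β))`. -/
theorem exists_kernel_bound [Nontrivial (Space d)] (hE : HasPositiveSpectrum E) {β : ℝ}
    (hβ : 0 < β) (hφ : IsHomogeneous E φ) (hφ' : IsAdmissible β E φ) (γ : ℝ) (x : Space d) :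
    ∃ K T : ℝ, 0 ≤ K ∧ 0 < T ∧ ∀ w, T ≤ φ w → |φ (x + w) ^ γ - φ w ^ γ| ≤ K * φ w ^ (γ - β) := by
  obtain ⟨A, B, hA, hAB, hshell⟩ :=
    exists_norm_between_of_homogeneous_eq_one hE hφ hφ'.continuous hφ'.pos
  obtain ⟨C, hC, hbound⟩ := hφ'.bound A B hA hAB
  obtain ⟨L, hL, hLip⟩ := exists_abs_rpow_sub_one_le γ
  set t := radialPart E x with ht
  have ht0 : 0 ≤ t := radialPart_nonneg x
  have htend : Tendsto (fun c : ℝ => C * (c⁻¹ * t) ^ β) atTop (𝓝 0) := by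
    have h1 : Tendsto (fun c : ℝ => c⁻¹ * t) atTop (𝓝 0) := by
      simpa using tendsto_inv_atTop_zero.mul_const t
    have h2 := (h1.rpow_const (p := β) (Or.inr hβ.le)).const_mul C
    rwa [Real.zero_rpow hβ.ne', mul_zero] at h2
  obtain ⟨T₀, hT₀⟩ := eventually_atTop.1
    (htend.eventually (ge_mem_nhds (show (0 : ℝ) < 1 / 2 by norm_num)))
  -- Here `T₀` makes `|u - 1| ≤ 1/2`, `t` makes `τ(c^(-E)x) ≤ 1`, and `1` keeps `c` positive.
  refine ⟨L * (C * t ^ β), max (max T₀ t) 1, by positivity, by positivity, fun w hw => ?_⟩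
  have hw1 : T₀ ≤ φ w := ((le_max_left _ _).trans (le_max_left _ _)).trans hw
  have hw2 : t ≤ φ w := ((le_max_right _ _).trans (le_max_left _ _)).trans hw
  have hc : 0 < φ w := zero_lt_one.trans_le ((le_max_right _ _).trans hw)
  set c := φ w with hcdef
  have hθ : φ (powOp c⁻¹ E w) = 1 := by
    rw [homogeneous_powOp hE hφ hφ'.continuous (inv_pos.2 hc), inv_mul_cancel₀ hc.ne']
  have hτ : radialPart E (powOp c⁻¹ E x) = c⁻¹ * t := radialPart_powOp (inv_pos.2 hc) x
  have hb := hbound (powOp c⁻¹ E x) (powOp c⁻¹ E w) (hshell _ hθ).1 (hshell _ hθ).2 (by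
    rw [hτ, inv_mul_le_one₀ hc]; exact hw2)
  rw [hθ, hτ] at hb
  have hu := hLip _ (hb.trans (hT₀ c hw1))
  set u := φ (powOp c⁻¹ E x + powOp c⁻¹ E w) with hudef
  have hxw : φ (x + w) = c * u := by
    rw [hudef, ← map_add, ← homogeneous_powOp hE hφ hφ'.continuous hc, powOp_powOp_inv hc]
  rw [hxw, Real.mul_rpow hc.le (hφ'.nonneg _)]
  have hfac : c ^ γ * u ^ γ - c ^ γ = c ^ γ * (u ^ γ - 1) := by ring
  rw [hfac, abs_mul, abs_of_pos (Real.rpow_pos_of_pos hc γ)]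
  calc c ^ γ * |u ^ γ - 1| ≤ c ^ γ * (L * (C * (c⁻¹ * t) ^ β)) := by
        refine mul_le_mul_of_nonneg_left (hu.trans (mul_le_mul_of_nonneg_left hb hL)) ?_
        positivity
    _ = L * (C * t ^ β) * c ^ (γ - β) := by
        rw [Real.mul_rpow (by positivity) ht0, Real.inv_rpow hc.le, Real.rpow_sub hc]
        ring

theorem measurable_maKernel (hcont : Continuous φ) (α H : ℝ) (x : Space d) :
    Measurable (maKernel E φ α H x) := by
  unfold maKernel
  have h1 : Measurable fun y => φ (x - y) := (hcont.comp (by fun_prop)).measurable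
  have h2 : Measurable fun y : Space d => φ (-y) := (hcont.comp (by fun_prop)).measurable
  exact (h1.pow_const _).sub (h2.pow_const _)

theorem memLp_maKernel (hE : HasPositiveSpectrum E) {β : ℝ} (hβ : 0 < β)
    (hφ : IsHomogeneous E φ) (hφ' : IsAdmissible β E φ) {α : ℝ} (hα : 0 < α) {H : ℝ}
    (hH : 0 < H) (hH' : H < β) (x : Space d) :
    MemLp (maKernel E φ α H x) (ENNReal.ofReal α) volume := by
  have hmeas := measurable_maKernel (E := E) hφ'.continuous α H x
  -- In dimension `0` the two terms of the kernel coincide.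
  rcases subsingleton_or_nontrivial (Space d) with hd | hd
  · have : maKernel E φ α H x = 0 := by
      funext y
      simp [maKernel, Subsingleton.elim (x - y) (-y)]
    rw [this]
    exact MemLp.zero
  refine ⟨hmeas.aestronglyMeasurable, ?_⟩
  rw [eLpNorm_lt_top_iff_lintegral_rpow_enorm_lt_top (by simpa using hα) ENNReal.ofReal_ne_top,
    ENNReal.toReal_ofReal hα.le]
  set γ := H - E.trace / α with hγ
  have hγα : γ * α = H * α - E.trace := by rw [hγ]; field_simp
  have hnorm : ∀ y, ‖maKernel E φ α H x y‖ₑ ^ α =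
      ENNReal.ofReal (|φ (x - y) ^ γ - φ (-y) ^ γ| ^ α) := by
    intro y
    rw [Real.enorm_eq_ofReal_abs, ENNReal.ofReal_rpow_of_nonneg (abs_nonneg _) hα.le]
    rfl
  simp only [hnorm]
  obtain ⟨K, T, hK, hT, hbound⟩ := exists_kernel_bound hE hβ hφ hφ' γ x
  obtain ⟨M, hM⟩ := exists_norm_le_of_homogeneous_le hE hφ hφ'.continuous hφ'.pos T
  obtain ⟨T', hT'⟩ := (isCompact_closedBall (0 : Space d) (‖x‖ + M)).exists_bound_of_continuousOn
    hφ'.continuous.continuousOn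
  have hφm := hφ'.continuous.measurable
  have hlow : ∀ S : ℝ, 0 < S →
      ∫⁻ y, Set.indicator {y | φ y < S} (fun y => ENNReal.ofReal (φ y ^ (γ * α))) y < ⊤ := by
    intro S hS
    rw [lintegral_indicator (measurableSet_lt hφm measurable_const)]
    exact setLIntegral_sublevel_lt_top hE hφ hφ'.continuous hφ'.pos
      (by rw [hγα]; simp only [sub_add_cancel]; positivity) hS
  have hhigh : ∫⁻ y, Set.indicator {y | T ≤ φ y}
      (fun y => ENNReal.ofReal (φ y ^ ((γ - β) * α))) y < ⊤ := by
    rw [lintegral_indicator (measurableSet_le measurable_const hφm)]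
    refine setLIntegral_superlevel_lt_top hE hφ hφ'.continuous hφ'.pos ?_ hT
    rw [sub_mul, hγα]
    nlinarith
  -- Where `φ(-y) < T`, `y` is bounded, hence so is `φ(x - y)`, by `T'`; the `+ 1` makes the
  -- inequality strict and the `max` makes the level positive.
  set g₁ := Set.indicator {y | φ y < max (T' + 1) 1}
    (fun y => ENNReal.ofReal (φ y ^ (γ * α))) with hg₁
  set g₂ := Set.indicator {y | φ y < T} (fun y => ENNReal.ofReal (φ y ^ (γ * α))) with hg₂
  set g₃ := Set.indicator {y | T ≤ φ y} (fun y => ENNReal.ofReal (φ y ^ ((γ - β) * α))) with hg₃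
  have hm₁ : Measurable g₁ := (hφm.pow_const _).ennreal_ofReal.indicator
    (measurableSet_lt hφm measurable_const)
  have hm₂ : Measurable g₂ := (hφm.pow_const _).ennreal_ofReal.indicator
    (measurableSet_lt hφm measurable_const)
  have hm₃ : Measurable g₃ := (hφm.pow_const _).ennreal_ofReal.indicator
    (measurableSet_le measurable_const hφm)
  have hle : ∀ y, ENNReal.ofReal (|φ (x - y) ^ γ - φ (-y) ^ γ| ^ α) ≤
      g₁ (x - y) + g₂ (-y) + ENNReal.ofReal (K ^ α) * g₃ (-y) := by
    intro y
    rcases lt_or_ge (φ (-y)) T with hy | hy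
    · have hy' : φ (x - y) < max (T' + 1) 1 := by
        have h1 : ‖y‖ ≤ M := by simpa using hM (-y) hy.le
        have h2 : ‖x - y‖ ≤ ‖x‖ + M := (norm_sub_le x y).trans (by linarith)
        have h3 := hT' (x - y) (by simpa using h2)
        exact lt_max_of_lt_left (lt_of_le_of_lt ((le_abs_self _).trans h3) (by linarith))
      rw [hg₁, hg₂, Set.indicator_of_mem (show x - y ∈ {y | φ y < max (T' + 1) 1} from hy'),
        Set.indicator_of_mem (show -y ∈ {y | φ y < T} from hy)]
      refine le_add_of_le_of_nonneg ?_ zero_le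
      have h4 : 0 ≤ φ (x - y) := hφ'.nonneg _
      have h5 : 0 ≤ φ (-y) := hφ'.nonneg _
      rw [← ENNReal.ofReal_add (by positivity) (by positivity), Real.rpow_mul h4, Real.rpow_mul h5]
      exact ENNReal.ofReal_le_ofReal
        (abs_sub_rpow_le (Real.rpow_nonneg h4 _) (Real.rpow_nonneg h5 _) hα.le)
    · rw [hg₃, Set.indicator_of_mem (show -y ∈ {y | T ≤ φ y} from hy)]
      refine le_add_of_nonneg_of_le zero_le ?_
      have h5 : 0 ≤ φ (-y) := hφ'.nonneg _
      rw [← ENNReal.ofReal_mul (by positivity), Real.rpow_mul h5,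
        ← Real.mul_rpow hK (by positivity)]
      refine ENNReal.ofReal_le_ofReal (Real.rpow_le_rpow (abs_nonneg _) ?_ hα.le)
      simpa [sub_eq_add_neg] using hbound (-y) hy
  refine (lintegral_mono hle).trans_lt ?_
  rw [lintegral_add_left (by fun_prop), lintegral_add_left (by fun_prop),
    lintegral_const_mul _ (by fun_prop), lintegral_sub_left_eq_self g₁ x,
    lintegral_neg_eq_self g₂, lintegral_neg_eq_self g₃]
  exact ENNReal.add_lt_top.2 ⟨ENNReal.add_lt_top.2 ⟨hlow _ (by positivity), hlow T hT⟩,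
    ENNReal.mul_lt_top ENNReal.ofReal_lt_top hhigh⟩

end

/-- The `α`-th power `∫ |f| ^ α` of the `L^α` quasi-norm. -/
def alphaMass {d : ℕ} (α : ℝ) (f : Space d → ℝ) : ENNReal :=
  ∫⁻ y, ‖f y‖ₑ ^ α

/-! ### Calculus of `∫|f|^α`, uniform in `α > 0`. -/

section AlphaMass

variable {d : ℕ} {α : ℝ} (hα : 0 < α)
include hα

theorem alphaMass_eq_eLpNorm_rpow (f : Space d → ℝ) :
    alphaMass α f = eLpNorm f (ENNReal.ofReal α) volume ^ α := by
  rw [eLpNorm_eq_lintegral_rpow_enorm_toReal (by simpa using hα) ENNReal.ofReal_ne_top,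
    ENNReal.toReal_ofReal hα.le, ← ENNReal.rpow_mul, one_div, inv_mul_cancel₀ hα.ne',
    ENNReal.rpow_one, alphaMass]

theorem alphaMass_lt_top {f : Space d → ℝ} (hf : MemLp f (ENNReal.ofReal α) volume) :
    alphaMass α f < ⊤ := by
  rw [alphaMass_eq_eLpNorm_rpow hα]
  exact ENNReal.rpow_lt_top_of_nonneg hα.le hf.2.ne

theorem tendsto_alphaMass_zero_iff {f : ℕ → Space d → ℝ} :
    Tendsto (fun n => alphaMass α (f n)) atTop (𝓝 0) ↔
      Tendsto (fun n => eLpNorm (f n) (ENNReal.ofReal α) volume) atTop (𝓝 0) := by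
  simp only [alphaMass_eq_eLpNorm_rpow hα]
  constructor <;> intro h
  · have := (ENNReal.continuous_rpow_const (y := α⁻¹)).tendsto 0 |>.comp h
    rw [ENNReal.zero_rpow_of_pos (inv_pos.2 hα)] at this
    refine this.congr fun n => ?_
    simp only [Function.comp, ← ENNReal.rpow_mul, mul_inv_cancel₀ hα.ne', ENNReal.rpow_one]
  · have := (ENNReal.continuous_rpow_const (y := α)).tendsto 0 |>.comp h
    rwa [ENNReal.zero_rpow_of_pos hα] at this

theorem alphaMass_add_le {f : Space d → ℝ} (hf : Measurable f) (g : Space d → ℝ) :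
    alphaMass α (fun y => f y + g y) ≤ 2 ^ α * (alphaMass α f + alphaMass α g) := by
  unfold alphaMass
  rw [← lintegral_add_left (by fun_prop), ← lintegral_const_mul' _ _
    (ENNReal.rpow_ne_top_of_nonneg hα.le (by simp))]
  refine lintegral_mono fun y => ?_
  calc ‖f y + g y‖ₑ ^ α ≤ (‖f y‖ₑ + ‖g y‖ₑ) ^ α :=
        ENNReal.rpow_le_rpow (enorm_add_le _ _) hα.le
    _ ≤ (2 * max ‖f y‖ₑ ‖g y‖ₑ) ^ α := by
        refine ENNReal.rpow_le_rpow ?_ hα.le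
        rw [two_mul]
        exact add_le_add (le_max_left _ _) (le_max_right _ _)
    _ = 2 ^ α * max (‖f y‖ₑ ^ α) (‖g y‖ₑ ^ α) := by
        rw [ENNReal.mul_rpow_of_nonneg _ _ hα.le, (ENNReal.monotone_rpow_of_nonneg hα.le).map_max]
    _ ≤ _ := by
        gcongr
        exact max_le le_self_add le_add_self

omit hα in
theorem alphaMass_neg (f : Space d → ℝ) : alphaMass α (fun y => -f y) = alphaMass α f := by
  simp [alphaMass]

theorem alphaMass_const_mul (c : ℝ) (f : Space d → ℝ) :
    alphaMass α (fun y => c * f y) = ENNReal.ofReal (|c| ^ α) * alphaMass α f := by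
  unfold alphaMass
  rw [← lintegral_const_mul' _ _ ENNReal.ofReal_ne_top]
  refine lintegral_congr fun y => ?_
  rw [enorm_mul, ENNReal.mul_rpow_of_nonneg _ _ hα.le, Real.enorm_eq_ofReal_abs c,
    ENNReal.ofReal_rpow_of_nonneg (abs_nonneg _) hα.le]

omit hα in
theorem tendsto_of_le_add_of_le_add {u δ : ℕ → ENNReal} {a : ENNReal} (ha : a ≠ ⊤)
    (hδ : Tendsto δ atTop (𝓝 0)) (h1 : ∀ n, u n ≤ a + δ n) (h2 : ∀ n, a ≤ u n + δ n) :
    Tendsto u atTop (𝓝 a) := by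
  refine tendsto_of_tendsto_of_tendsto_of_le_of_le ?_ ?_ (fun n => tsub_le_iff_right.2 (h2 n)) h1
  · simpa using ENNReal.Tendsto.sub (tendsto_const_nhds (x := a)) hδ (Or.inl ha)
  · simpa using (tendsto_const_nhds (x := a)).add hδ

/-- For `α ≤ 1` the mass is itself subadditive; for `α ≥ 1` its `α`-th root is, by Minkowski. -/
theorem tendsto_alphaMass {s : ℕ → Space d → ℝ} {f : Space d → ℝ} (hs : ∀ n, Measurable (s n))
    (hf : Measurable f) (hfin : alphaMass α f ≠ ⊤)
    (h : Tendsto (fun n => alphaMass α (fun y => s n y - f y)) atTop (𝓝 0)) :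
    Tendsto (fun n => alphaMass α (s n)) atTop (𝓝 (alphaMass α f)) := by
  have hsf : ∀ n y, ‖s n y‖ₑ ≤ ‖f y‖ₑ + ‖s n y - f y‖ₑ := fun n y => by
    simpa using enorm_add_le (f y) (s n y - f y)
  have hfs : ∀ n y, ‖f y‖ₑ ≤ ‖s n y‖ₑ + ‖s n y - f y‖ₑ := fun n y => by
    have := enorm_add_le (s n y) (-(s n y - f y))
    rw [enorm_neg] at this
    simpa using this
  rcases le_total α 1 with h1 | h1
  · have key : ∀ u v w : Space d → ℝ, Measurable v →
        (∀ y, ‖u y‖ₑ ≤ ‖v y‖ₑ + ‖w y‖ₑ) → alphaMass α u ≤ alphaMass α v + alphaMass α w := by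
      intro u v w hv huv
      unfold alphaMass
      rw [← lintegral_add_left (by fun_prop)]
      exact lintegral_mono fun y => (ENNReal.rpow_le_rpow (huv y) hα.le).trans
        (ENNReal.rpow_add_le_add_rpow _ _ hα.le h1)
    exact tendsto_of_le_add_of_le_add hfin h (fun n => key _ _ _ hf (hsf n))
      (fun n => key _ _ _ (hs n) (hfs n))
  · have key : ∀ u v w : Space d → ℝ, Measurable v → Measurable w →
        (∀ y, ‖u y‖ₑ ≤ ‖v y‖ₑ + ‖w y‖ₑ) →
        alphaMass α u ^ (1 / α) ≤ alphaMass α v ^ (1 / α) + alphaMass α w ^ (1 / α) := by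
      intro u v w hv hw huv
      refine le_trans ?_ (ENNReal.lintegral_Lp_add_le (f := fun y => ‖v y‖ₑ)
        (g := fun y => ‖w y‖ₑ) hv.enorm.aemeasurable hw.enorm.aemeasurable h1)
      refine ENNReal.rpow_le_rpow (lintegral_mono fun y => ?_) (by positivity)
      exact ENNReal.rpow_le_rpow (huv y) hα.le
    have hδ : Tendsto (fun n => alphaMass α (fun y => s n y - f y) ^ (1 / α)) atTop (𝓝 0) := by
      have := (ENNReal.continuous_rpow_const (y := 1 / α)).tendsto 0 |>.comp h
      rwa [ENNReal.zero_rpow_of_pos (by positivity)] at this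
    have hroot := tendsto_of_le_add_of_le_add
      (ENNReal.rpow_ne_top_of_nonneg (y := 1 / α) (by positivity) hfin) hδ
      (fun n => key _ _ _ hf ((hs n).sub hf) (hsf n))
      (fun n => key _ _ _ (hs n) ((hs n).sub hf) (hfs n))
    have hpow := (ENNReal.continuous_rpow_const (y := α)).tendsto _ |>.comp hroot
    have hid : ∀ x : ENNReal, (x ^ (1 / α)) ^ α = x := fun x => by
      rw [← ENNReal.rpow_mul, one_div, inv_mul_cancel₀ hα.ne', ENNReal.rpow_one]
    simpa only [Function.comp_def, hid] using hpow

theorem toReal_alphaMass_simpleFunc (s : SimpleFunc (Space d) ℝ) (hs : s.FinMeasSupp volume) :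
    (alphaMass α s).toReal = ∑ a ∈ s.range with a ≠ 0, |a| ^ α * volume.real (s ⁻¹' {a}) := by
  have h1 : alphaMass α s = ∑ a ∈ s.range, ‖a‖ₑ ^ α * volume (s ⁻¹' {a}) := by
    rw [← SimpleFunc.map_lintegral (fun a : ℝ => ‖a‖ₑ ^ α), ← SimpleFunc.lintegral_eq_lintegral]
    rfl
  have h2 : ∑ a ∈ s.range, ‖a‖ₑ ^ α * volume (s ⁻¹' {a}) =
      ∑ a ∈ s.range with a ≠ 0, ‖a‖ₑ ^ α * volume (s ⁻¹' {a}) := by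
    rw [Finset.sum_filter]
    refine Finset.sum_congr rfl fun a _ => ?_
    split_ifs with ha
    · rfl
    · simp [not_not.1 ha, ENNReal.zero_rpow_of_pos hα]
  rw [h1, h2, ENNReal.toReal_sum]
  · refine Finset.sum_congr rfl fun a _ => ?_
    rw [ENNReal.toReal_mul, ← ENNReal.toReal_rpow, toReal_enorm, Real.norm_eq_abs]
    rfl
  · intro a ha
    exact ENNReal.mul_ne_top (ENNReal.rpow_ne_top_of_nonneg hα.le enorm_ne_top)
      (SimpleFunc.finMeasSupp_iff.1 hs a (Finset.mem_filter.1 ha).2).ne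

end AlphaMass

/-! ### Stable random measures and their integrals. -/

section RandomMeasure

variable {d : ℕ} {Ω : Type*} [MeasurableSpace Ω] {α : ℝ} {P : Measure Ω}
  {Z : Set (Space d) → Ω → ℝ}

/-- For the constant sequence `∅` the partial sums `n Z(∅)` converge, so their increments `Z(∅)`
tend to `0`. -/
theorem IsStableRandomMeasure.ae_empty (hZ : IsStableRandomMeasure α P Z) :
    ∀ᵐ ω ∂P, Z ∅ ω = 0 := by
  filter_upwards [hZ.sigma_additive (fun _ => ∅) (fun _ => MeasurableSet.empty)
    (fun _ _ _ => disjoint_bot_left) (by simp)] with ω hω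
  have h1 := (tendsto_add_atTop_iff_nat 1).2 hω
  have h2 := h1.sub hω
  simp only [Finset.sum_range_succ, add_sub_cancel_left, sub_self] at h2
  exact tendsto_nhds_unique tendsto_const_nhds h2

theorem IsStableRandomMeasure.ae_union (hZ : IsStableRandomMeasure α P Z) {A B : Set (Space d)}
    (hA : MeasurableSet A) (hB : MeasurableSet B) (hAB : Disjoint A B) (hAfin : volume A < ⊤)
    (hBfin : volume B < ⊤) : ∀ᵐ ω ∂P, Z (A ∪ B) ω = Z A ω + Z B ω := by
  let S : ℕ → Set (Space d) := fun n => if n = 0 then A else if n = 1 then B else ∅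
  have hU : ⋃ n, S n = A ∪ B := by
    ext y
    simp only [Set.mem_iUnion, Set.mem_union]
    constructor
    · rintro ⟨n, hn⟩
      by_cases h0 : n = 0
      · simp only [S, h0, if_true] at hn
        exact Or.inl hn
      · by_cases h1 : n = 1
        · simp only [S, h1, if_true, one_ne_zero, if_false] at hn
          exact Or.inr hn
        · simp [S, h0, h1] at hn
    · rintro (h | h)
      · exact ⟨0, by simpa [S] using h⟩
      · exact ⟨1, by simpa [S] using h⟩
  have hSm : ∀ n, MeasurableSet (S n) := by
    intro n
    simp only [S]
    split_ifs <;> simp [hA, hB]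
  have hSd : Pairwise fun i j => Disjoint (S i) (S j) := by
    intro i j hij
    simp only [S]
    split_ifs <;> first | omega | exact hAB | exact hAB.symm | simp
  have h := hZ.sigma_additive S hSm hSd (by
    rw [hU]; exact measure_union_lt_top hAfin hBfin)
  filter_upwards [h, hZ.ae_empty] with ω hω h0
  rw [hU] at hω
  refine tendsto_nhds_unique hω (tendsto_const_nhds.congr' ?_)
  filter_upwards [eventually_ge_atTop 2] with n hn
  rw [← Finset.sum_subset (Finset.range_subset_range.2 hn)]
  · simp [Finset.sum_range_succ, S]
  · intro k _ hk
    simp only [Finset.mem_range, not_lt] at hk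
    have hk0 : k ≠ 0 := by omega
    have hk1 : k ≠ 1 := by omega
    simpa [S, hk0, hk1] using h0

theorem IsStableRandomMeasure.ae_biUnion (hZ : IsStableRandomMeasure α P Z) {ι : Type*}
    (A : ι → Set (Space d)) (S : Finset ι) (hA : ∀ i ∈ S, MeasurableSet (A i))
    (hd : (S : Set ι).PairwiseDisjoint A) (hfin : ∀ i ∈ S, volume (A i) < ⊤) :
    ∀ᵐ ω ∂P, Z (⋃ i ∈ S, A i) ω = ∑ i ∈ S, Z (A i) ω := by
  classical
  induction S using Finset.induction_on with
  | empty => simpa using hZ.ae_empty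
  | insert i S hi ih =>
    have hrec := ih (fun j hj => hA j (Finset.mem_insert_of_mem hj))
      (hd.subset (by simp)) (fun j hj => hfin j (Finset.mem_insert_of_mem hj))
    have hdisj : Disjoint (A i) (⋃ j ∈ S, A j) := by
      refine Set.disjoint_iUnion₂_right.2 fun j hj => hd (by simp) (by simp [hj]) ?_
      rintro rfl
      exact hi hj
    have hun := hZ.ae_union (hA i (Finset.mem_insert_self i S))
      (Finset.measurableSet_biUnion S fun j hj => hA j (Finset.mem_insert_of_mem hj)) hdisj
      (hfin i (Finset.mem_insert_self i S))
      (measure_biUnion_lt_top S.finite_toSet fun j hj => hfin j (Finset.mem_insert_of_mem hj))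
    filter_upwards [hrec, hun] with ω h1 h2
    rw [Finset.set_biUnion_insert, h2, h1, Finset.sum_insert hi]

/-- The integral may be computed on any finer partition. Taking `p` to be a pair of simple functions
puts both on a common partition, whence additivity. -/
theorem IsStableRandomMeasure.ae_simpleIntegral_map (hZ : IsStableRandomMeasure α P Z)
    {ι : Type*} (p : SimpleFunc (Space d) ι) (g : ι → ℝ) (hp : (p.map g).FinMeasSupp volume) :
    ∀ᵐ ω ∂P, simpleIntegral Z (p.map g) ω = ∑ b ∈ p.range, g b * Z (p ⁻¹' {b}) ω := by
  classical
  have hkey : ∀ b ∈ p.range, ∀ᵐ ω ∂P, g b * Z (p.map g ⁻¹' {g b}) ω =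
      ∑ b' ∈ p.range with g b' = g b, g b' * Z (p ⁻¹' {b'}) ω := by
    intro b _
    -- The level set of `0` may have infinite measure, where `Z` is not additive, but its weight
    -- vanishes.
    by_cases hb : g b = 0
    · refine Eventually.of_forall fun ω => ?_
      rw [hb, zero_mul, Finset.sum_eq_zero]
      intro b' hb'
      rw [(Finset.mem_filter.1 hb').2, zero_mul]
    · have hfin := SimpleFunc.finMeasSupp_iff.1 hp (g b) hb
      have hset : (p.map g ⁻¹' {g b} : Set (Space d)) =
          ⋃ b' ∈ p.range.filter (fun b' => g b' = g b), p ⁻¹' {b'} := by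
        ext y
        simp
      filter_upwards [hZ.ae_biUnion (fun b' => p ⁻¹' {b'})
        (p.range.filter (fun b' => g b' = g b)) (fun b' _ => p.measurableSet_preimage _)
        (fun x _ y _ hxy => (Set.disjoint_singleton.2 hxy).preimage p)
        (fun b' hb' => (measure_mono (by
          rw [hset]
          exact Set.subset_biUnion_of_mem (u := fun b' => p ⁻¹' {b'}) hb')).trans_lt hfin)]
        with ω hω
      rw [hset, hω, Finset.mul_sum]
      exact Finset.sum_congr rfl fun b' hb' => by rw [(Finset.mem_filter.1 hb').2]
  filter_upwards [(ae_ball_iff p.range.countable_toSet).2 hkey] with ω hω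
  rw [simpleIntegral, SimpleFunc.range_map]
  exact Finset.sum_image' _ hω

theorem IsStableRandomMeasure.ae_simpleIntegral_add (hZ : IsStableRandomMeasure α P Z)
    {s t : SimpleFunc (Space d) ℝ} (hs : s.FinMeasSupp volume) (ht : t.FinMeasSupp volume) :
    ∀ᵐ ω ∂P, simpleIntegral Z (s + t) ω = simpleIntegral Z s ω + simpleIntegral Z t ω := by
  filter_upwards [hZ.ae_simpleIntegral_map (s.pair t) (fun p => p.1 + p.2) (hs.add ht),
    hZ.ae_simpleIntegral_map (s.pair t) Prod.fst (by simpa using hs),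
    hZ.ae_simpleIntegral_map (s.pair t) Prod.snd (by simpa using ht)] with ω h1 h2 h3
  rw [SimpleFunc.map_fst_pair] at h2
  rw [SimpleFunc.map_snd_pair] at h3
  rw [h2, h3, ← Finset.sum_add_distrib]
  simp only [← add_mul]
  exact h1

theorem IsStableRandomMeasure.ae_simpleIntegral_const_mul (hZ : IsStableRandomMeasure α P Z)
    (c : ℝ) {s : SimpleFunc (Space d) ℝ} (hs : s.FinMeasSupp volume) :
    ∀ᵐ ω ∂P, simpleIntegral Z (s.map (c * ·)) ω = c * simpleIntegral Z s ω := by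
  filter_upwards [hZ.ae_simpleIntegral_map s (c * ·) (hs.map (by simp))] with ω h
  rw [h, simpleIntegral, Finset.mul_sum]
  simp only [mul_assoc]

omit [MeasurableSpace Ω] in
theorem simpleIntegral_eq_sum_ne_zero (Z : Set (Space d) → Ω → ℝ)
    (s : SimpleFunc (Space d) ℝ) (ω : Ω) :
    simpleIntegral Z s ω = ∑ a ∈ s.range with a ≠ 0, a * Z (s ⁻¹' {a}) ω := by
  rw [simpleIntegral, Finset.sum_filter]
  refine Finset.sum_congr rfl fun a _ => ?_
  split_ifs with h
  · rfl
  · simp [not_not.1 h]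

theorem IsStableRandomMeasure.measurable_simpleIntegral (hZ : IsStableRandomMeasure α P Z)
    {s : SimpleFunc (Space d) ℝ} (hs : s.FinMeasSupp volume) :
    Measurable (simpleIntegral Z s) := by
  rw [funext (simpleIntegral_eq_sum_ne_zero Z s)]
  refine Finset.measurable_fun_sum _ fun a ha => ?_
  exact (hZ.measurable _ (s.measurableSet_preimage _)
    (SimpleFunc.finMeasSupp_iff.1 hs a (Finset.mem_filter.1 ha).2)).const_mul a

theorem IsStableRandomMeasure.charFun_simpleIntegral [IsProbabilityMeasure P]
    (hZ : IsStableRandomMeasure α P Z) (hα : 0 < α) {s : SimpleFunc (Space d) ℝ}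
    (hs : s.FinMeasSupp volume) (t : ℝ) :
    charFun (P.map (simpleIntegral Z s)) t =
      (Real.exp (-((alphaMass α s).toReal * |t| ^ α)) : ℂ) := by
  set S := s.range.filter (fun a => a ≠ 0) with hS
  let e := S.equivFin.symm
  have hfin : ∀ i, volume (s ⁻¹' {(e i : ℝ)}) < ⊤ := fun i =>
    SimpleFunc.finMeasSupp_iff.1 hs _ (Finset.mem_filter.1 (e i).2).2
  have hmeas : ∀ i, Measurable (Z (s ⁻¹' {(e i : ℝ)})) := fun i =>
    hZ.measurable _ (s.measurableSet_preimage _) (hfin i)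
  have hind := (hZ.indep S.card (fun i => s ⁻¹' {(e i : ℝ)})
    (fun i => s.measurableSet_preimage _) hfin (fun i j hij =>
      (Set.disjoint_singleton.2 fun h => hij (e.injective (Subtype.ext h))).preimage s)).comp
    (fun i z => (e i : ℝ) * z) (fun i => measurable_const_mul _)
  have hsum : simpleIntegral Z s = fun ω => ∑ i, (e i : ℝ) * Z (s ⁻¹' {(e i : ℝ)}) ω := by
    funext ω
    rw [simpleIntegral_eq_sum_ne_zero, ← Finset.sum_coe_sort,
      ← Equiv.sum_comp e (fun a : S => (a : ℝ) * Z (s ⁻¹' {(a : ℝ)}) ω)]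
  have hchar := hind.charFun_map_fun_sum_eq_prod
    (fun i => ((hmeas i).const_mul (e i : ℝ)).aemeasurable)
  rw [hsum]
  refine (congrFun hchar t).trans ?_
  have hfactor : ∀ i, charFun (P.map (fun ω => (e i : ℝ) * Z (s ⁻¹' {(e i : ℝ)}) ω)) t =
      (Real.exp (-(|(e i : ℝ)| ^ α * volume.real (s ⁻¹' {(e i : ℝ)}) * |t| ^ α)) : ℂ) := by
    intro i
    refine (charFun_map_mul_comp (hmeas i).aemeasurable _ _).trans ?_
    rw [hZ.law _ (s.measurableSet_preimage _) (hfin i), abs_mul,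
      Real.mul_rpow (abs_nonneg _) (abs_nonneg _)]
    congr 3
    ring
  have hreindex : ∑ i, |(e i : ℝ)| ^ α * volume.real (s ⁻¹' {(e i : ℝ)}) * |t| ^ α =
      ∑ a ∈ S, |a| ^ α * volume.real (s ⁻¹' {a}) * |t| ^ α := by
    rw [← Finset.sum_coe_sort S, ← Equiv.sum_comp e (fun a : S =>
      |(a : ℝ)| ^ α * volume.real (s ⁻¹' {(a : ℝ)}) * |t| ^ α)]
  rw [Finset.prod_apply, Finset.prod_congr rfl fun i _ => hfactor i, ← Complex.ofReal_prod,
    ← Real.exp_sum, toReal_alphaMass_simpleFunc hα s hs, Finset.sum_neg_distrib, Finset.sum_mul,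
    hreindex]

/-- Tails are controlled by the characteristic function on `[-2/r, 2/r]`, where `1 - exp(-x) ≤ x`.
This turns smallness in `L^α` into smallness in probability. -/
theorem IsStableRandomMeasure.measureReal_lt_abs_simpleIntegral_le [IsProbabilityMeasure P]
    (hZ : IsStableRandomMeasure α P Z) (hα : 0 < α) {s : SimpleFunc (Space d) ℝ}
    (hs : s.FinMeasSupp volume) {r : ℝ} (hr : 0 < r) :
    P.real {ω | r < |simpleIntegral Z s ω|} ≤ 2 * ((alphaMass α s).toReal * (2 * r⁻¹) ^ α) := by
  have hm := hZ.measurable_simpleIntegral hs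
  have hprob : IsProbabilityMeasure (P.map (simpleIntegral Z s)) :=
    Measure.isProbabilityMeasure_map hm.aemeasurable
  have h := measureReal_abs_gt_le_integral_charFun (μ := P.map (simpleIntegral Z s)) hr
  rw [map_measureReal_apply hm (measurableSet_lt measurable_const continuous_abs.measurable)] at h
  refine h.trans ?_
  have hbound : ∀ t ∈ Set.uIoc (-2 * r⁻¹) (2 * r⁻¹),
      ‖1 - charFun (P.map (simpleIntegral Z s)) t‖ ≤
        (alphaMass α s).toReal * (2 * r⁻¹) ^ α := by
    intro t ht
    rw [hZ.charFun_simpleIntegral hα hs]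
    have hle : -2 * r⁻¹ ≤ 2 * r⁻¹ := by nlinarith [inv_pos.2 hr]
    rw [Set.uIoc_of_le hle] at ht
    have htabs : |t| ≤ 2 * r⁻¹ := abs_le.2 ⟨by linarith [ht.1], ht.2⟩
    set x := (alphaMass α s).toReal * |t| ^ α with hx
    have hx0 : 0 ≤ x := by positivity
    have h1 : ‖(1 : ℂ) - (Real.exp (-x) : ℂ)‖ = 1 - Real.exp (-x) := by
      rw [← Complex.ofReal_one, ← Complex.ofReal_sub, Complex.norm_real, Real.norm_of_nonneg]
      simp [hx0]
    rw [h1]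
    have h2 := Real.add_one_le_exp (-x)
    have h3 : x ≤ (alphaMass α s).toReal * (2 * r⁻¹) ^ α := by
      rw [hx]
      gcongr
    linarith
  have hint := intervalIntegral.norm_integral_le_of_norm_le_const hbound
  have hlen : |2 * r⁻¹ - -2 * r⁻¹| = 4 * r⁻¹ := by
    rw [abs_of_nonneg] <;> nlinarith [inv_pos.2 hr]
  rw [hlen] at hint
  calc 2⁻¹ * r * ‖∫ t in (-2 * r⁻¹)..(2 * r⁻¹), 1 - charFun (P.map (simpleIntegral Z s)) t‖
      ≤ 2⁻¹ * r * ((alphaMass α s).toReal * (2 * r⁻¹) ^ α * (4 * r⁻¹)) := by gcongr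
    _ = _ := by field_simp; ring

theorem isStableIntegral_zero (α : ℝ) (P : Measure Ω) (Z : Set (Space d) → Ω → ℝ) :
    IsStableIntegral α P Z (fun _ => 0) (fun _ => 0) := by
  refine ⟨measurable_const, MemLp.zero, fun _ => 0, fun _ => ?_, ?_, ?_⟩
  · rw [SimpleFunc.finMeasSupp_iff_support]
    simp
  · simp
  · have : ∀ ω, simpleIntegral Z (0 : SimpleFunc (Space d) ℝ) ω = 0 := fun ω => by
      rw [simpleIntegral_eq_sum_ne_zero]
      refine Finset.sum_eq_zero fun a ha => ?_
      obtain ⟨h1, h2⟩ := Finset.mem_filter.1 ha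
      obtain ⟨y, hy⟩ := SimpleFunc.mem_range.1 h1
      exact absurd hy.symm h2
    intro ε hε
    simp [this, hε.ne']

theorem IsStableIntegral.const_mul {f : Space d → ℝ} {Y : Ω → ℝ} [IsFiniteMeasure P]
    (hZ : IsStableRandomMeasure α P Z) (hα : 0 < α)
    (hY : IsStableIntegral α P Z f Y) (c : ℝ) :
    IsStableIntegral α P Z (fun y => c * f y) (fun ω => c * Y ω) := by
  obtain ⟨hm, hf, s, hs, hsf, hlim⟩ := hY
  refine ⟨hm.const_mul c, hf.const_mul c, fun n => (s n).map (c * ·),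
    fun n => (hs n).map (by simp), ?_, ?_⟩
  · rw [← tendsto_alphaMass_zero_iff hα] at hsf ⊢
    have h := ENNReal.Tendsto.const_mul (a := ENNReal.ofReal (|c| ^ α)) hsf
      (Or.inr ENNReal.ofReal_ne_top)
    rw [mul_zero] at h
    refine h.congr fun n => ?_
    rw [← alphaMass_const_mul hα]
    simp [mul_sub]
  · have h : TendstoInMeasure P (fun n ω => c * simpleIntegral Z (s n) ω) atTop
        (fun ω => c * Y ω) := by
      rw [tendstoInMeasure_iff_measureReal_norm] at hlim ⊢
      intro ε hε
      refine squeeze_zero (fun n => measureReal_nonneg) (fun n => measureReal_mono ?_)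
        -- The `+ 1` covers `c = 0`.
        (hlim (ε / (|c| + 1)) (by positivity))
      intro ω hω
      simp only [Set.mem_ofPred_eq, ← mul_sub, norm_mul, Real.norm_eq_abs] at hω ⊢
      rw [div_le_iff₀ (by positivity)]
      nlinarith [abs_nonneg c, abs_nonneg (simpleIntegral Z (s n) ω - Y ω)]
    exact h.congr_left fun n => by
      filter_upwards [hZ.ae_simpleIntegral_const_mul c (hs n)] with ω hω using hω.symm

theorem IsStableIntegral.add {f g : Space d → ℝ} {Y W : Ω → ℝ} [IsFiniteMeasure P]
    (hZ : IsStableRandomMeasure α P Z) (hα : 0 < α) (hfm : Measurable f)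
    (hY : IsStableIntegral α P Z f Y) (hW : IsStableIntegral α P Z g W) :
    IsStableIntegral α P Z (fun y => f y + g y) (fun ω => Y ω + W ω) := by
  obtain ⟨hm, hf, s, hs, hsf, hlim⟩ := hY
  obtain ⟨hm', hg, t, ht, htg, hlim'⟩ := hW
  refine ⟨hm.add hm', hf.add hg, fun n => s n + t n, fun n => (hs n).add (ht n), ?_, ?_⟩
  · rw [← tendsto_alphaMass_zero_iff hα] at hsf htg ⊢
    have h := ENNReal.Tendsto.const_mul (a := (2 : ENNReal) ^ α) (hsf.add htg)
      (Or.inr (ENNReal.rpow_ne_top_of_nonneg hα.le (by simp)))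
    rw [add_zero, mul_zero] at h
    refine tendsto_of_tendsto_of_tendsto_of_le_of_le tendsto_const_nhds h
      (fun n => zero_le) (fun n => ?_)
    refine le_trans (le_of_eq ?_)
      (alphaMass_add_le hα ((s n).measurable.sub hfm) (fun y => t n y - g y))
    congr 1
    funext y
    simp only [SimpleFunc.coe_add, Pi.add_apply, Pi.sub_apply]
    ring
  · have h : TendstoInMeasure P
        (fun n ω => simpleIntegral Z (s n) ω + simpleIntegral Z (t n) ω) atTop
        (fun ω => Y ω + W ω) := by
      rw [tendstoInMeasure_iff_measureReal_norm] at hlim hlim' ⊢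
      intro ε hε
      have hsum := (hlim (ε / 2) (by positivity)).add (hlim' (ε / 2) (by positivity))
      rw [add_zero] at hsum
      refine squeeze_zero (fun n => measureReal_nonneg) (fun n => ?_) hsum
      refine (measureReal_mono ?_).trans (measureReal_union_le _ _)
      intro ω hω
      simp only [Set.mem_union, Set.mem_ofPred_eq, Real.norm_eq_abs] at hω ⊢
      by_contra! hlt
      have := abs_add_le (simpleIntegral Z (s n) ω - Y ω) (simpleIntegral Z (t n) ω - W ω)
      rw [show simpleIntegral Z (s n) ω - Y ω + (simpleIntegral Z (t n) ω - W ω) =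
        simpleIntegral Z (s n) ω + simpleIntegral Z (t n) ω - (Y ω + W ω) by ring] at this
      linarith [hlt.1, hlt.2]
    exact h.congr_left fun n => by
      filter_upwards [hZ.ae_simpleIntegral_add (hs n) (ht n)] with ω hω using hω.symm

theorem IsStableIntegral.sum {ι : Type*} (S : Finset ι) {f : ι → Space d → ℝ} {Y : ι → Ω → ℝ}
    [IsFiniteMeasure P] (hZ : IsStableRandomMeasure α P Z) (hα : 0 < α)
    (hfm : ∀ i, Measurable (f i)) (hY : ∀ i, IsStableIntegral α P Z (f i) (Y i)) :
    IsStableIntegral α P Z (fun y => ∑ i ∈ S, f i y) (fun ω => ∑ i ∈ S, Y i ω) := by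
  classical
  induction S using Finset.induction_on with
  | empty => simpa using isStableIntegral_zero α P Z
  | insert i S hi ih =>
    simp only [Finset.sum_insert hi]
    exact (hY i).add hZ hα (hfm i) ih

/-- Convergence in probability implies convergence of characteristic functions, and those of the
simple integrals converge because the mass is continuous in `L^α`. -/
theorem IsStableIntegral.charFun_eq [IsProbabilityMeasure P] {f : Space d → ℝ} {Y : Ω → ℝ}
    (hZ : IsStableRandomMeasure α P Z) (hα : 0 < α) (hfm : Measurable f)
    (hY : IsStableIntegral α P Z f Y) (t : ℝ) :
    charFun (P.map Y) t = (Real.exp (-((alphaMass α f).toReal * |t| ^ α)) : ℂ) := by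
  obtain ⟨hm, hf, s, hs, hsf, hlim⟩ := hY
  have hsm : ∀ n, AEMeasurable (simpleIntegral Z (s n)) P := fun n =>
    (hZ.measurable_simpleIntegral (hs n)).aemeasurable
  have h1 := ProbabilityMeasure.tendsto_iff_tendsto_charFun.1
    (hlim.tendstoInDistribution hsm).tendsto t
  simp only [ProbabilityMeasure.coe_mk] at h1
  have hfin : alphaMass α f ≠ ⊤ := (alphaMass_lt_top hα hf).ne
  have h2 := tendsto_alphaMass hα (fun n => (s n).measurable) hfm hfin
    ((tendsto_alphaMass_zero_iff hα).2 hsf)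
  have h3 := (ENNReal.tendsto_toReal hfin).comp h2
  have h4 : Tendsto (fun n => (Real.exp (-((alphaMass α (s n)).toReal * |t| ^ α)) : ℂ)) atTop
      (𝓝 (Real.exp (-((alphaMass α f).toReal * |t| ^ α)) : ℂ)) := by
    refine (Complex.continuous_ofReal.tendsto _).comp ((Real.continuous_exp.tendsto _).comp ?_)
    exact (h3.mul_const _).neg
  refine tendsto_nhds_unique h1 (h4.congr fun n => ?_)
  exact (hZ.charFun_simpleIntegral hα (hs n) t).symm

theorem exists_simpleFunc_tendsto_alphaMass (hα : 0 < α) {f : Space d → ℝ}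
    (hf : MemLp f (ENNReal.ofReal α) volume) :
    ∃ s : ℕ → SimpleFunc (Space d) ℝ, (∀ n, (s n).FinMeasSupp volume) ∧
      Tendsto (fun n => alphaMass α (fun y => s n y - f y)) atTop (𝓝 0) := by
  have hne : ENNReal.ofReal α ≠ 0 := by simpa using hα
  have hex : ∀ n : ℕ, ∃ g : SimpleFunc (Space d) ℝ,
      eLpNorm (f - ⇑g) (ENNReal.ofReal α) volume < (n + 1 : ENNReal)⁻¹ ∧
        MemLp g (ENNReal.ofReal α) volume := fun n =>
    hf.exists_simpleFunc_eLpNorm_sub_lt ENNReal.ofReal_ne_top (by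
      simp only [ne_eq, ENNReal.inv_eq_zero]
      exact ENNReal.add_ne_top.2 ⟨ENNReal.natCast_ne_top n, ENNReal.one_ne_top⟩)
  choose s hs1 hs2 using hex
  refine ⟨s, fun n => (SimpleFunc.memLp_iff_finMeasSupp hne ENNReal.ofReal_ne_top).1 (hs2 n), ?_⟩
  rw [tendsto_alphaMass_zero_iff hα]
  have hzero : Tendsto (fun n : ℕ => (n + 1 : ENNReal)⁻¹) atTop (𝓝 0) := by
    have := (tendsto_add_atTop_iff_nat 1).2 ENNReal.tendsto_inv_nat_nhds_zero
    simpa using this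
  refine tendsto_of_tendsto_of_tendsto_of_le_of_le tendsto_const_nhds hzero
    (fun n => zero_le) (fun n => ?_)
  refine le_trans (le_of_eq ?_) (hs1 n).le
  rw [← eLpNorm_neg]
  congr 1
  funext y
  simp

/-- Along a subsequence the increments exceed `2^(-n)` with probability at most `2^(-n)`;
Borel–Cantelli makes it almost surely Cauchy. -/
theorem exists_isStableIntegral [IsProbabilityMeasure P] (hZ : IsStableRandomMeasure α P Z)
    (hα : 0 < α) {f : Space d → ℝ} (hfm : Measurable f)
    (hf : MemLp f (ENNReal.ofReal α) volume) : ∃ Y, IsStableIntegral α P Z f Y := by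
  obtain ⟨s, hs, hsf⟩ := exists_simpleFunc_tendsto_alphaMass hα hf
  have hdiff : ∀ n m, alphaMass α ⇑(s n - s m) ≤ 2 ^ α *
      (alphaMass α (fun y => s n y - f y) + alphaMass α (fun y => s m y - f y)) := by
    intro n m
    rw [← alphaMass_neg (fun y => s m y - f y)]
    refine le_trans (le_of_eq ?_)
      (alphaMass_add_le hα ((s n).measurable.sub hfm) (fun y => -(s m y - f y)))
    congr 1
    funext y
    simp only [SimpleFunc.coe_sub, Pi.sub_apply]
    ring
  -- Chosen so that the tail bound at `r = 2^(-n)` equals `2^(-n)`.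
  let δ : ℕ → ℝ := fun n => (1 / 2) ^ n / (2 * (2 * ((1 / 2 : ℝ) ^ n)⁻¹) ^ α)
  have hδ : ∀ n, 0 < δ n := fun n => by positivity
  have hcauchy : ∀ n, ∀ᶠ k in atTop, ∀ m, k ≤ m →
      alphaMass α ⇑(s m - s k) ≤ ENNReal.ofReal (δ n) := by
    intro n
    have h2 : Tendsto (fun k => 2 ^ α * (alphaMass α (fun y => s k y - f y))) atTop (𝓝 0) := by
      have := ENNReal.Tendsto.const_mul (a := (2 : ENNReal) ^ α) hsf
        (Or.inr (ENNReal.rpow_ne_top_of_nonneg hα.le (by simp)))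
      rwa [mul_zero] at this
    obtain ⟨k₀, hk₀⟩ := eventually_atTop.1 (h2.eventually (ge_mem_nhds
      (show (0 : ENNReal) < ENNReal.ofReal (δ n / 2) by simpa using hδ n)))
    refine eventually_atTop.2 ⟨k₀, fun k hk m hm => (hdiff m k).trans ?_⟩
    rw [mul_add]
    refine (add_le_add (hk₀ m (hk.trans hm)) (hk₀ k hk)).trans ?_
    rw [← ENNReal.ofReal_add (half_pos (hδ n)).le (half_pos (hδ n)).le, add_halves]
  obtain ⟨ψ, hψ, hψs⟩ := extraction_forall_of_eventually hcauchy
  set I : ℕ → Ω → ℝ := fun n => simpleIntegral Z (s (ψ n)) with hI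
  have hIm : ∀ n, Measurable (I n) := fun n => hZ.measurable_simpleIntegral (hs _)
  have hsub : ∀ n, (s (ψ (n + 1)) - s (ψ n)).FinMeasSupp volume := fun n => by
    have h := (hs (ψ (n + 1))).add ((hs (ψ n)).map (g := fun a : ℝ => -a) neg_zero)
    have heq : s (ψ (n + 1)) - s (ψ n) = s (ψ (n + 1)) + (s (ψ n)).map (fun a : ℝ => -a) := by
      ext y
      simp [sub_eq_add_neg]
    rw [heq]
    exact h
  have hprob : ∀ n, P {ω | (1 / 2 : ℝ) ^ n <
      |simpleIntegral Z (s (ψ (n + 1)) - s (ψ n)) ω|} ≤ ENNReal.ofReal ((1 / 2) ^ n) := by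
    intro n
    rw [← ofReal_measureReal]
    refine ENNReal.ofReal_le_ofReal ?_
    refine (hZ.measureReal_lt_abs_simpleIntegral_le hα (hsub n) (by positivity)).trans ?_
    have h1 : (alphaMass α ⇑(s (ψ (n + 1)) - s (ψ n))).toReal ≤ δ n :=
      ENNReal.toReal_le_of_le_ofReal (hδ n).le (hψs n _ (hψ (Nat.lt_succ_self n)).le)
    calc 2 * ((alphaMass α ⇑(s (ψ (n + 1)) - s (ψ n))).toReal * (2 * ((1 / 2 : ℝ) ^ n)⁻¹) ^ α)
        ≤ 2 * (δ n * (2 * ((1 / 2 : ℝ) ^ n)⁻¹) ^ α) := by gcongr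
      _ = (1 / 2) ^ n := by
        have : (0 : ℝ) < (2 * ((1 / 2 : ℝ) ^ n)⁻¹) ^ α := by positivity
        simp only [δ]
        field_simp
  have hBC := ae_eventually_notMem (μ := P) (s := fun n => {ω | (1 / 2 : ℝ) ^ n <
      |simpleIntegral Z (s (ψ (n + 1)) - s (ψ n)) ω|}) (by
    refine ne_top_of_le_ne_top ?_ (ENNReal.tsum_le_tsum hprob)
    exact (summable_geometric_of_lt_one (by norm_num) (by norm_num)).tsum_ofReal_ne_top)
  have hadd : ∀ᵐ ω ∂P, ∀ n, I (n + 1) ω =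
      I n ω + simpleIntegral Z (s (ψ (n + 1)) - s (ψ n)) ω := by
    refine ae_all_iff.2 fun n => ?_
    filter_upwards [hZ.ae_simpleIntegral_add (hs (ψ n)) (hsub n)] with ω hω
    rwa [add_sub_cancel] at hω
  obtain ⟨Y, hYm, hY⟩ := measurable_limit_of_tendsto_metrizable_ae (L := atTop)
    (fun n => (hIm n).aemeasurable (μ := P)) (by
      filter_upwards [hBC, hadd] with ω h1 h2
      refine cauchySeq_tendsto_of_complete (cauchySeq_of_summable_dist ?_)
      refine Summable.of_norm_bounded_eventually_nat
        (summable_geometric_of_lt_one (r := (1 / 2 : ℝ)) (by norm_num) (by norm_num)) ?_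
      filter_upwards [h1] with n hn
      rw [Real.norm_of_nonneg dist_nonneg, dist_comm, Real.dist_eq, h2 n, add_sub_cancel_left]
      simpa using hn)
  refine ⟨Y, hYm, hf, fun n => s (ψ n), fun n => hs _, ?_, ?_⟩
  · exact ((tendsto_alphaMass_zero_iff hα).1 hsf).comp hψ.tendsto_atTop
  · exact tendstoInMeasure_of_tendsto_ae (fun n => (hIm n).aestronglyMeasurable) hY

end RandomMeasure

/-! ### Finite-dimensional laws of fields of stable integrals. -/

section RandomField

variable {d : ℕ} {Ω : Type*} [MeasurableSpace Ω] {α : ℝ} {P : Measure Ω} [IsProbabilityMeasure P]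
  {Z : Set (Space d) → Ω → ℝ}

theorem charFun_map_sum_isStableIntegral (hZ : IsStableRandomMeasure α P Z) (hα : 0 < α)
    {m : ℕ} {k : Fin m → Space d → ℝ} (hk : ∀ j, Measurable (k j)) {X : Fin m → Ω → ℝ}
    (hX : ∀ j, IsStableIntegral α P Z (k j) (X j)) (θ : Fin m → ℝ) (t : ℝ) :
    charFun (P.map fun ω => ∑ j, θ j * X j ω) t =
      (Real.exp (-((alphaMass α fun y => ∑ j, θ j * k j y).toReal * |t| ^ α)) : ℂ) :=
  (IsStableIntegral.sum Finset.univ hZ hα (fun j => (hk j).const_mul (θ j))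
    (fun j => (hX j).const_mul hZ hα (θ j))).charFun_eq hZ hα
      (Finset.measurable_fun_sum _ fun j _ => (hk j).const_mul (θ j)) t

omit [IsProbabilityMeasure P] in
-- The Cramér–Wold reduction: joint laws are tested through linear combinations.
theorem charFunDual_map_pi {m : ℕ} {X : Fin m → Ω → ℝ} (hX : ∀ j, Measurable (X j))
    (L : StrongDual ℝ (Fin m → ℝ)) :
    charFunDual (P.map fun ω j => X j ω) L =
      charFun (P.map fun ω => ∑ j, L (Pi.single j 1) * X j ω) 1 := by
  rw [charFunDual_eq_charFun_map_one, Measure.map_map L.continuous.measurable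
    (measurable_pi_lambda _ hX)]
  congr 2
  funext ω
  simp only [Function.comp]
  conv_lhs => rw [pi_eq_sum_univ' (fun j => X j ω)]
  rw [map_sum]
  refine Finset.sum_congr rfl fun j _ => ?_
  rw [map_smul, smul_eq_mul, mul_comm]

/-- Fields of stable integrals have the same finite-dimensional distributions as soon as
corresponding linear combinations of their kernels have the same `L^α` quasi-norm. -/
theorem fddEq_of_alphaMass_eq (hZ : IsStableRandomMeasure α P Z) (hα : 0 < α)
    {k l : Space d → Space d → ℝ} (hk : ∀ x, Measurable (k x)) (hl : ∀ x, Measurable (l x))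
    {X Y : Space d → Ω → ℝ} (hX : ∀ x, IsStableIntegral α P Z (k x) (X x))
    (hY : ∀ x, IsStableIntegral α P Z (l x) (Y x))
    (h : ∀ (m : ℕ) (x : Fin m → Space d) (θ : Fin m → ℝ),
      alphaMass α (fun y => ∑ j, θ j * k (x j) y) = alphaMass α (fun y => ∑ j, θ j * l (x j) y)) :
    FddEq P X Y := by
  intro m x
  have hXm : Measurable fun ω (j : Fin m) => X (x j) ω := measurable_pi_lambda _ fun j => (hX _).1
  have hYm : Measurable fun ω (j : Fin m) => Y (x j) ω := measurable_pi_lambda _ fun j => (hY _).1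
  refine ⟨hXm.aemeasurable, hYm.aemeasurable, ?_⟩
  have := Measure.isProbabilityMeasure_map (μ := P) hXm.aemeasurable
  have := Measure.isProbabilityMeasure_map (μ := P) hYm.aemeasurable
  refine Measure.ext_of_charFunDual (funext fun L => ?_)
  rw [charFunDual_map_pi (X := fun j => X (x j)) fun j => (hX _).1,
    charFunDual_map_pi (X := fun j => Y (x j)) fun j => (hY _).1,
    charFun_map_sum_isStableIntegral hZ hα (fun j => hk (x j)) (fun j => hX (x j)),
    charFun_map_sum_isStableIntegral hZ hα (fun j => hl (x j)) (fun j => hY (x j)), h]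

end RandomField

/-! ### Scaling and increments of the moving-average field. -/

section MovingAverage

variable {d : ℕ} {E : Matrix (Fin d) (Fin d) ℝ} {φ : Space d → ℝ}

theorem maKernel_powOp (hE : HasPositiveSpectrum E) (hφ : IsHomogeneous E φ)
    (hcont : Continuous φ) (hnn : ∀ x, 0 ≤ φ x) (α H : ℝ) {c : ℝ} (hc : 0 < c) (x y : Space d) :
    maKernel E φ α H (powOp c E x) (powOp c E y) =
      c ^ (H - E.trace / α) * maKernel E φ α H x y := by
  rcases subsingleton_or_nontrivial (Space d) with hd | hd
  · have h0 : ∀ v w : Space d, maKernel E φ α H v w = 0 := fun v w => by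
      simp [maKernel, Subsingleton.elim (v - w) (-w)]
    rw [h0, h0, mul_zero]
  · simp only [maKernel]
    rw [← map_sub, ← map_neg, homogeneous_powOp hE hφ hcont hc, homogeneous_powOp hE hφ hcont hc,
      Real.mul_rpow hc.le (hnn _), Real.mul_rpow hc.le (hnn _), mul_sub]

/-- The normalising terms at `-y` cancel in the increment, leaving a translate. -/
theorem maKernel_add (α H : ℝ) (x h y : Space d) :
    maKernel E φ α H (x + h) y - maKernel E φ α H h y = maKernel E φ α H x (y - h) := by
  simp only [maKernel, show x + h - y = x - (y - h) by abel, show h - y = -(y - h) by abel]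
  ring

theorem alphaMass_comp_powOp {α : ℝ} {c : ℝ} (hc : 0 < c) (E : Matrix (Fin d) (Fin d) ℝ)
    {f : Space d → ℝ} (hf : Measurable f) :
    alphaMass α f = ENNReal.ofReal (c ^ E.trace) * alphaMass α fun y => f (powOp c E y) := by
  unfold alphaMass
  have h := lintegral_comp_powOp hc E (g := fun y => ‖f y‖ₑ ^ α) (by fun_prop)
  rw [h, ← mul_assoc, ← ENNReal.ofReal_mul (by positivity), ← Real.rpow_add hc]
  simp

variable {Ω : Type*} [MeasurableSpace Ω] {α H : ℝ} {P : Measure Ω} [IsProbabilityMeasure P]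
  {Z : Set (Space d) → Ω → ℝ} {X : Space d → Ω → ℝ}

theorem IsMovingAverageField.isOperatorScaling (hX : IsMovingAverageField E φ α H P Z X)
    (hZ : IsStableRandomMeasure α P Z) (hα : 0 < α) (hE : HasPositiveSpectrum E)
    (hφ : IsHomogeneous E φ) (hcont : Continuous φ) (hnn : ∀ x, 0 ≤ φ x) :
    IsOperatorScaling P E H X := by
  intro c hc
  have hm := measurable_maKernel (E := E) hcont α H
  refine fddEq_of_alphaMass_eq hZ hα (fun x => hm (powOp c E x))
    (fun x => (hm x).const_mul (c ^ H)) (fun x => hX (powOp c E x))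
    (fun x => (hX x).const_mul hZ hα (c ^ H)) fun m x θ => ?_
  rw [alphaMass_comp_powOp hc E
    (Finset.measurable_fun_sum _ fun j _ => (hm (powOp c E (x j))).const_mul (θ j))]
  have hl : ∀ y, ∑ j, θ j * maKernel E φ α H (powOp c E (x j)) (powOp c E y) =
      c ^ (H - E.trace / α) * ∑ j, θ j * maKernel E φ α H (x j) y := fun y => by
    rw [Finset.mul_sum]
    refine Finset.sum_congr rfl fun j _ => ?_
    rw [maKernel_powOp hE hφ hcont hnn α H hc]
    ring
  have hr : ∀ y, ∑ j, θ j * (c ^ H * maKernel E φ α H (x j) y) =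
      c ^ H * ∑ j, θ j * maKernel E φ α H (x j) y := fun y => by
    rw [Finset.mul_sum]
    exact Finset.sum_congr rfl fun j _ => by ring
  simp only [hl, hr]
  rw [alphaMass_const_mul hα, alphaMass_const_mul hα, ← mul_assoc,
    ← ENNReal.ofReal_mul (by positivity), abs_of_pos (Real.rpow_pos_of_pos hc _),
    abs_of_pos (Real.rpow_pos_of_pos hc _), ← Real.rpow_mul hc.le, ← Real.rpow_mul hc.le,
    ← Real.rpow_add hc]
  -- What remains is the exponent identity `q + (H - q/α)α = Hα`.
  congr 3
  field_simp
  ring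

theorem IsMovingAverageField.hasStationaryIncrements
    (hX : IsMovingAverageField E φ α H P Z X) (hZ : IsStableRandomMeasure α P Z) (hα : 0 < α)
    (hcont : Continuous φ) : HasStationaryIncrements P X := by
  intro h
  have hm := measurable_maKernel (E := E) hcont α H
  have hinc : ∀ x, IsStableIntegral α P Z (fun y => maKernel E φ α H x (y - h))
      (fun ω => X (x + h) ω - X h ω) := fun x => by
    have := (hX (x + h)).add hZ hα (hm _) ((hX h).const_mul hZ hα (-1))
    simpa only [neg_one_mul, ← sub_eq_add_neg, maKernel_add] using this
  refine fddEq_of_alphaMass_eq hZ hα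
    (fun x => (hm x).comp (measurable_sub_const h)) hm hinc hX fun m x θ => ?_
  exact lintegral_sub_right_eq_self
    (fun y => ‖∑ j, θ j * maKernel E φ α H (x j) y‖ₑ ^ α) h

end MovingAverage

end OperatorScaling

end

open OperatorScaling in
theorem corollary3p2 {d : ℕ} (E : Matrix (Fin d) (Fin d) ℝ) (hE : HasPositiveSpectrum E)
    (β : ℝ) (hβ : 0 < β) (φ : Space d → ℝ) (hφ : IsHomogeneous E φ) (hφ' : IsAdmissible β E φ)
    (α : ℝ) (hα : 0 < α) (hα' : α ≤ 2) (H : ℝ) (hH : 0 < H) (hH' : H < β)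
    {Ω : Type*} [MeasurableSpace Ω] (P : Measure Ω) [IsProbabilityMeasure P]
    (Z : Set (Space d) → Ω → ℝ) (hZ : IsStableRandomMeasure α P Z) :
    (∃ X : Space d → Ω → ℝ, IsMovingAverageField E φ α H P Z X) ∧
    ∀ X : Space d → Ω → ℝ, IsMovingAverageField E φ α H P Z X →
      IsOperatorScaling P E H X ∧ HasStationaryIncrements P X := by
  refine ⟨?_, fun X hX => ⟨hX.isOperatorScaling hZ hα hE hφ hφ'.continuous hφ'.nonneg,
    hX.hasStationaryIncrements hZ hα hφ'.continuous⟩⟩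
  -- Each `X(x)` is chosen separately; only finite-dimensional laws matter, so no joint regularity
  -- in `x` is needed.
  choose X hX using fun x => exists_isStableIntegral hZ hα
    (measurable_maKernel (E := E) hφ'.continuous α H x)
    (memLp_maKernel hE hβ hφ hφ' hα hH hH' x)
  exact ⟨X, hX⟩
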